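/- For $X\subseteq\mathbb R$ and $A\subseteq X$ let $X^{i}_{A}$, $X^{l}_{A}$, $X^{r}_{A}$ denote the set $X$ with the topology generated by the Euclidean topology of $X$ together with, respectively, all sets $\{x\}$, all sets $X\cap(-\infty,x]$, all sets $X\cap[x,+\infty)$, where $x\in X\setminus A$. A space $X$ is *Lindelöf to countable degree* if $X^{\omega}$ is Lindelöf. The *discrete Suslin number* of $X$ is the supremum of the cardinalities of discrete families of nonempty open subsets of $X$ (a family is discrete if each point of $X$ has a neighbourhood meeting at most one member of it); the *extent* of $X$ is the supremum of the cardinalities of closed discrete subsets of $X$. $B(X)$ is the free Boolean topological group over $X$, i.e. the free Boolean group with basis $X$, endowed with the finest group topology for which the inclusion $X\to B(X)$ is continuous. A group $G$ with a topology is *$\mathcal{SG}_{cnw}$-factorizable* if for every continuous $f:G\to\mathbb R$ there are a semitopological group $S$ (a group with a topology in which multiplication is separately continuous) with a countable network, a continuous homomorphism $g:G\to S$ and a continuous $h:S\to\mathbb R$ with $f=h\circ g$; it is *$\mathbb R$-factorizable* if the same holds with $S$ a separable metrizable topological group. There exists a partition $\{M_\alpha:\alpha<2^{\omega}\}$ of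 $\mathbb R$ into nonempty sets such that $(\mathbb R^{i}_{M_\alpha})^{\omega}$ is Lindelöf for every $\alpha<2^\omega$. For every such partition and any two different members $A$ and $B$ of it, put $C=\mathbb R\setminus(A\cup B)$, $L=A\cup C$, $R=B\cup C$ and $$G_1=B(L^{i}_{A}),\quad H_1=B(R^{i}_{B}),\quad G_2=B(L^{l}_{A}),\quad H_2=B(R^{r}_{B}).$$ Then the topological groups $G_1,H_1,G_2,H_2$ are Lindelöf to countable degree, and: 1. the product $G_1\times H_1$ is not $\mathcal{SG}_{cnw}$-factorizable, is not $\mathbb R$-factorizable, and has discrete Suslin number $2^{\omega}$; 2. the product $G_2\times H_2$ is not $\mathcal{SG}_{cnw}$-factorizable, is not $\mathbb R$-factorizable, is not normal, is separable, and has extent $2^{\omega}$. -/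

import Mathlib

open Set Topology Cardinal

namespace BoolProd

noncomputable section

universe u

/-! ### Topological notions -/

/-- `X` is Lindelöf to countable degree: the countable power `X ^ ω` (with the product topology)
is Lindelöf. -/
def LindelofToCountableDegree (X : Type u) [TopologicalSpace X] : Prop :=
  LindelofSpace (ℕ → X)

/-- `N` is a network of `X`: every open set is a union of members of `N`. -/
def IsNetwork {X : Type u} [TopologicalSpace X] (N : Set (Set X)) : Prop :=
  ∀ U : Set X, IsOpen U → ∀ x ∈ U, ∃ P ∈ N, x ∈ P ∧ P ⊆ U

/-- `X` has a countable network. -/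
def HasCountableNetwork (X : Type u) [TopologicalSpace X] : Prop :=
  ∃ N : Set (Set X), N.Countable ∧ IsNetwork N

/-- A family `F` of subsets of `X` is discrete: every point of `X` has a neighbourhood which meets
at most one member of `F`. -/
def IsDiscreteFamily {X : Type u} [TopologicalSpace X] (F : Set (Set X)) : Prop :=
  ∀ x : X, ∃ U ∈ 𝓝 x, {V ∈ F | (V ∩ U).Nonempty}.Subsingleton

/-- The discrete Suslin number of `X`: the supremum of the cardinalities of discrete families of
nonempty open subsets of `X`. -/
def discreteSuslinNumber (X : Type u) [TopologicalSpace X] : Cardinal.{u} :=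
  ⨆ F : {F : Set (Set X) // (∀ V ∈ F, IsOpen V ∧ V.Nonempty) ∧ IsDiscreteFamily F}, #(F.1)

/-- The extent of `X`: the supremum of the cardinalities of closed discrete subsets of `X`. -/
def extent (X : Type u) [TopologicalSpace X] : Cardinal.{u} :=
  ⨆ D : {D : Set X // IsClosed D ∧ IsDiscrete D}, #(D.1)

/-! ### Factorizability of groups with a topology -/

/-- The group with topology `G` is `SG_cnw`-factorizable: every continuous real function on `G`
factors through a continuous homomorphism to a semitopological group (a group with a separately
continuous operation) that has a countable network. -/
def SGcnwFactorizable (G : Type u) [AddGroup G] [TopologicalSpace G] : Prop :=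
  ∀ f : G → ℝ, Continuous f →
    ∃ (S : Type u) (_ : AddGroup S) (_ : TopologicalSpace S),
      SeparatelyContinuousAdd S ∧ HasCountableNetwork S ∧
      ∃ (g : G →+ S) (h : S → ℝ), Continuous g ∧ Continuous h ∧ f = h ∘ g

/-- The group with topology `G` is `ℝ`-factorizable: every continuous real function on `G`
factors through a continuous homomorphism to a separable metrizable topological group. -/
def RFactorizable (G : Type u) [AddGroup G] [TopologicalSpace G] : Prop :=
  ∀ f : G → ℝ, Continuous f →
    ∃ (S : Type u) (_ : AddGroup S) (_ : TopologicalSpace S),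
      IsTopologicalAddGroup S ∧ TopologicalSpace.SeparableSpace S ∧
      TopologicalSpace.MetrizableSpace S ∧
      ∃ (g : G →+ S) (h : S → ℝ), Continuous g ∧ Continuous h ∧ f = h ∘ g

/-! ### Free Boolean topological groups -/

/-- The free Boolean group with basis `X`, written additively (its elements are the finite subsets
of `X`, its operation is the symmetric difference). -/
def FreeBooleanGroup (X : Type u) : Type u := X →₀ ZMod 2

instance (X : Type u) : AddCommGroup (FreeBooleanGroup X) :=
  inferInstanceAs (AddCommGroup (X →₀ ZMod 2))

/-- The canonical inclusion of the basis. -/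
def FreeBooleanGroup.of {X : Type u} (x : X) : FreeBooleanGroup X :=
  (Finsupp.single x 1 : X →₀ ZMod 2)

/-- The finest group topology on the free Boolean group on `X` for which the inclusion of `X` is
continuous (in Mathlib's order of topologies, finer means smaller). -/
def FreeBooleanGroup.groupTopology (X : Type u) [TopologicalSpace X] :
    AddGroupTopology (FreeBooleanGroup X) :=
  sInf {t : AddGroupTopology (FreeBooleanGroup X) |
    Continuous[inferInstance, t.toTopologicalSpace] (FreeBooleanGroup.of (X := X))}

/-- The free Boolean topological group `B(X)`. -/
instance (X : Type u) [TopologicalSpace X] : TopologicalSpace (FreeBooleanGroup X) :=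
  (FreeBooleanGroup.groupTopology X).toTopologicalSpace

instance (X : Type u) [TopologicalSpace X] : IsTopologicalAddGroup (FreeBooleanGroup X) :=
  (FreeBooleanGroup.groupTopology X).toIsTopologicalAddGroup

/-! ### Modifications of the topology of a subset of the line

For `X ⊆ ℝ` and a set `A`, these are the set `X` with the topology generated by the Euclidean
topology of `X` together with, for every `x ∈ X \ A`, the set `{x}`, respectively
`X ∩ (-∞, x]`, respectively `X ∩ [x, +∞)`. -/

/-- `X` with the points of `X \ A` made isolated. -/
def SpI (X _A : Set ℝ) : Type := X

/-- `X` with the sets `X ∩ (-∞, x]`, `x ∈ X \ A`, made open. -/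
def SpL (X _A : Set ℝ) : Type := X

/-- `X` with the sets `X ∩ [x, +∞)`, `x ∈ X \ A`, made open. -/
def SpR (X _A : Set ℝ) : Type := X

instance (X A : Set ℝ) : TopologicalSpace (SpI X A) :=
  TopologicalSpace.generateFrom
    ({U : Set X | IsOpen U} ∪ {U : Set X | ∃ x : X, (x : ℝ) ∉ A ∧ U = {x}})

instance (X A : Set ℝ) : TopologicalSpace (SpL X A) :=
  TopologicalSpace.generateFrom
    ({U : Set X | IsOpen U} ∪ {U : Set X | ∃ x : X, (x : ℝ) ∉ A ∧ U = Set.Iic x})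

instance (X A : Set ℝ) : TopologicalSpace (SpR X A) :=
  TopologicalSpace.generateFrom
    ({U : Set X | IsOpen U} ∪ {U : Set X | ∃ x : X, (x : ℝ) ∉ A ∧ U = Set.Ici x})

/-! ### Okunev–Tamano partitions and the groups built from them -/

/-- `M` is a partition of the line into `2 ^ ω` nonempty pieces such that, for every piece `M i`,
the line with all points outside `M i` made isolated is Lindelöf to countable degree. -/
structure IsOkunevTamanoPartition {ι : Type} (M : ι → Set ℝ) : Prop where
  card_index : #ι = 𝔠
  nonempty : ∀ i, (M i).Nonempty
  disjoint : ∀ i j, i ≠ j → Disjoint (M i) (M j)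
  cover : ⋃ i, M i = Set.univ
  lindelof : ∀ i, LindelofToCountableDegree (SpI Set.univ (M i))

/-- `C = ℝ \ (A ∪ B)`. -/
def setC (A B : Set ℝ) : Set ℝ := (A ∪ B)ᶜ

/-- `L = A ∪ C`. -/
def setL (A B : Set ℝ) : Set ℝ := A ∪ setC A B

/-- `R = B ∪ C`. -/
def setR (A B : Set ℝ) : Set ℝ := B ∪ setC A B

/-- `G₁`: the free Boolean topological group over `L` with the points of `L \ A` isolated. -/
abbrev G1 (A B : Set ℝ) : Type := FreeBooleanGroup (SpI (setL A B) A)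

/-- `H₁`: the free Boolean topological group over `R` with the points of `R \ B` isolated. -/
abbrev H1 (A B : Set ℝ) : Type := FreeBooleanGroup (SpI (setR A B) B)

/-- `G₂`: the free Boolean topological group over `L` with the rays `L ∩ (-∞, x]`, `x ∈ L \ A`,
made open. -/
abbrev G2 (A B : Set ℝ) : Type := FreeBooleanGroup (SpL (setL A B) A)

/-- `H₂`: the free Boolean topological group over `R` with the rays `R ∩ [x, +∞)`, `x ∈ R \ B`,
made open. -/
abbrev H2 (A B : Set ℝ) : Type := FreeBooleanGroup (SpR (setR A B) B)

end

end BoolProd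

/-! Existence of the partition. Call a set of real sequences large if no countable part of a given
cover of the `ω`-th power covers it. If the whole space were large, repeated halving of large sets
would give a Cantor tree of large sets in which each coordinate either becomes constant along a
branch or tends to different limits along different branches, up to countably many exceptions. If
all limits of the non-constant coordinates along one branch lie in `M`, then the limit sequence has
a basic neighbourhood, Euclidean at those coordinates, which swallows a whole node of the branch,
and the cover is contradicted (`lindelof_of_limitSet_subset`). There are only `𝔠` trees, each limit
set is countable and each real belongs to the limit sets of countably many branches, so a
transfinite recursion of length at most `𝔠` colours the line so that every colour class absorbs a
branch of every tree (`exists_coloring`).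

The groups. A countable power of `B(X)` is a continuous image of a closed subset of a countable
power of the modified line, hence Lindelöf.

The products. A dense sequence in `B` misses `L` and cuts it into a binary tree of clopen convex
cells. An element of `B(L)` with an odd number of letters has exactly one odd half inside each odd
cell; the resulting branch ends at a single letter, the root. The topology of `B(L)` is fine enough
to control the parities on all pieces of an open partition at once, so the root depends continuously
on the element even for the one-sided or isolated neighbourhoods (`eventually_isRoot_mem`). The same
holds for `R`, cut along `A`.

Since `L` and `R` meet exactly in `C`, at a common root the left root can be kept on the left and
the right root on the right. Hence the condition "left root ≤ right root" is locally constant on the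
product, and near each point at most one value is a common root of both components. The first fact
gives a continuous function coding the order of `C`, which no countable network can resolve
(`not_SGcnwFactorizable`). The second gives a closed discrete set, and a discrete open family when
the points of `C` are isolated, of size `𝔠`; non-normality follows from separability by Jones'
lemma. -/

namespace BoolProd

/-! ### Existence of Okunev–Tamano partitions -/

/-- Given at most `𝔠` many families of countable sets indexed by a set of size `𝔠`, where each
family is point-countable, there is a colouring such that every family has a member which is
monochromatic in any prescribed colour. -/
theorem exists_coloring {ι K T E : Type} [Nonempty ι] (hι : #ι ≤ 𝔠) (hK : #K ≤ 𝔠) (hT : #T = 𝔠)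
    (S : K → T → Set E) (hS : ∀ k t, (S k t).Countable)
    (hfib : ∀ k y, {t | y ∈ S k t}.Countable) :
    ∃ m : E → ι, ∀ i k, ∃ t, ∀ y ∈ S k t, m y = i := by
  classical
  have hJ : #(ι × K) ≤ 𝔠 := by
    rw [Cardinal.mk_prod, Cardinal.lift_id, Cardinal.lift_id]
    exact (mul_le_mul' hι hK).trans Cardinal.continuum_mul_self.le
  -- A well-order of minimal type: all proper initial segments have fewer than `𝔠` elements.
  obtain ⟨r, wo, hr⟩ := Cardinal.exists_ord_eq (ι × K)
  have avoid : ∀ (j : ι × K) (prev : {j' // r j' j} → T),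
      ∃ t, ∀ j', Disjoint (S j.2 t) (S j'.1.2 (prev j')) := by
    intro j prev
    have hlt : #{j' // r j' j} < 𝔠 := lt_of_lt_of_le (Cardinal.card_typein_lt j hr) hJ
    -- The indices forbidden by one earlier choice: countably many points, each lying in countably
    -- many members of the family.
    let Bd : {j' // r j' j} → Set T := fun j' => ⋃ y ∈ S j'.1.2 (prev j'), {t | y ∈ S j.2 t}
    have hBd : ∀ j', #(Bd j') ≤ ℵ₀ := fun j' =>
      Cardinal.le_aleph0_iff_set_countable.2 ((hS _ _).biUnion fun y _ => hfib _ y)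
    have hU : #(⋃ j', Bd j') < 𝔠 := by
      refine (Cardinal.mk_iUnion_le Bd).trans_lt ?_
      refine (mul_le_mul' le_rfl (ciSup_le' hBd)).trans_lt ?_
      exact Cardinal.mul_lt_of_lt Cardinal.aleph0_le_continuum hlt Cardinal.aleph0_lt_continuum
    have : ∃ t, t ∉ ⋃ j', Bd j' := by
      by_contra! h
      rw [eq_univ_of_forall h, Cardinal.mk_univ, hT] at hU
      exact hU.false
    obtain ⟨t, ht⟩ := this
    refine ⟨t, fun j' => Set.disjoint_left.2 fun y hy hy' => ht ?_⟩
    exact mem_iUnion.2 ⟨j', mem_biUnion hy' hy⟩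
  choose pick hpick using avoid
  let tt : ι × K → T := wo.wf.fix fun j prev => pick j fun j' => prev j'.1 j'.2
  have htt : ∀ j, tt j = pick j fun j' => tt j'.1 := fun j => wo.wf.fix_eq _ j
  have hdis : ∀ j j', r j' j → Disjoint (S j.2 (tt j)) (S j'.2 (tt j')) := by
    intro j j' h
    have := hpick j (fun j' => tt j'.1) ⟨j', h⟩
    rwa [← htt] at this
  have hinj : ∀ j j' y, y ∈ S j.2 (tt j) → y ∈ S j'.2 (tt j') → j = j' := by
    intro j j' y h h'
    rcases trichotomous_of r j j' with hj | hj | hj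
    · exact absurd h (Set.disjoint_left.1 (hdis _ _ hj) h')
    · exact hj
    · exact absurd h' (Set.disjoint_left.1 (hdis _ _ hj) h)
  refine ⟨fun y => if h : ∃ j : ι × K, y ∈ S j.2 (tt j) then h.choose.1
    else Classical.arbitrary ι, fun i k => ⟨tt (i, k), fun y hy => ?_⟩⟩
  have h : ∃ j : ι × K, y ∈ S j.2 (tt j) := ⟨(i, k), hy⟩
  simp only [dif_pos h, hinj _ (i, k) y h.choose_spec hy]

/-! ### Shrinking and splitting large sets of real sequences. -/

section Splitting

variable {Bad : Set (ℕ → ℝ) → Prop}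

/-- A family of large sets of real sequences: the complement of a `σ`-ideal. -/
structure IsLarge (Bad : Set (ℕ → ℝ) → Prop) : Prop where
  not_empty : ¬ Bad ∅
  mono : ∀ {Z W}, Bad Z → Z ⊆ W → Bad W
  iUnion : ∀ {Z : ℕ → Set (ℕ → ℝ)}, Bad (⋃ k, Z k) → ∃ k, Bad (Z k)

theorem IsLarge.exists_of_countable (hB : IsLarge Bad) {α : Type} [Countable α]
    {Z : Set (ℕ → ℝ)} (hZ : Bad Z) (W : α → Set (ℕ → ℝ)) (hW : Z ⊆ ⋃ a, W a) :
    ∃ a, Bad (Z ∩ W a) := by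
  rcases isEmpty_or_nonempty α with h | h
  · rw [iUnion_of_empty] at hW
    exact absurd (hB.mono hZ hW) hB.not_empty
  · obtain ⟨e, he⟩ := exists_surjective_nat α
    have : Z = ⋃ k, Z ∩ W (e k) := by
      rw [← inter_iUnion, he.iUnion_comp W]
      exact (inter_eq_left.2 hW).symm
    rw [this] at hZ
    obtain ⟨k, hk⟩ := hB.iUnion hZ
    exact ⟨_, hk⟩

theorem IsLarge.inter_or_diff (hB : IsLarge Bad) {Z : Set (ℕ → ℝ)} (hZ : Bad Z)
    (W : Set (ℕ → ℝ)) : Bad (Z ∩ W) ∨ Bad (Z ∩ Wᶜ) := by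
  obtain ⟨b, hb⟩ := hB.exists_of_countable hZ (fun b : Bool => if b then W else Wᶜ)
    (fun z _ => by
      by_cases h : z ∈ W
      · exact mem_iUnion.2 ⟨true, by simpa⟩
      · exact mem_iUnion.2 ⟨false, by simpa⟩)
  cases b
  · right; simpa using hb
  · left; simpa using hb

theorem IsLarge.exists_small (hB : IsLarge Bad) {Z : Set (ℕ → ℝ)} (hZ : Bad Z) (n : ℕ) {ε : ℝ}
    (hε : 0 < ε) : ∃ W ⊆ Z, Bad W ∧ ∀ z ∈ W, ∀ z' ∈ W, |z n - z' n| ≤ ε := by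
  obtain ⟨a, ha⟩ := hB.exists_of_countable hZ (fun a : ℤ => {z | ⌊z n / ε⌋ = a})
    (fun z _ => mem_iUnion.2 ⟨_, rfl⟩)
  refine ⟨_, inter_subset_left, ha, ?_⟩
  rintro z ⟨-, hz⟩ z' ⟨-, hz'⟩
  have h := Int.abs_sub_lt_one_of_floor_eq_floor (hz.trans hz'.symm)
  rw [← sub_div, abs_div, abs_of_pos hε, div_lt_one hε] at h
  exact h.le

/-- Otherwise every real has a ball carrying only a negligible part of `Z`, and countably many of
these balls cover the line. -/
theorem IsLarge.exists_support (hB : IsLarge Bad) {Z : Set (ℕ → ℝ)} (hZ : Bad Z) (n : ℕ) :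
    ∃ r : ℝ, ∀ ε > 0, Bad (Z ∩ {z | |z n - r| < ε}) := by
  by_contra! h
  choose ε hε hb using h
  obtain ⟨s, hs, hcov⟩ := TopologicalSpace.countable_cover_nhds
    (f := fun r => Metric.ball r (ε r)) (fun r => Metric.ball_mem_nhds r (hε r))
  have := hs.to_subtype
  obtain ⟨a, ha⟩ := hB.exists_of_countable hZ (fun a : s => {z | |z n - a| < ε a}) (by
    intro z _
    have : z n ∈ ⋃ r ∈ s, Metric.ball r (ε r) := hcov ▸ mem_univ _
    obtain ⟨r, hr, h⟩ := mem_iUnion₂.1 this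
    exact mem_iUnion.2 ⟨⟨r, hr⟩, by simpa [Real.dist_eq] using h⟩)
  exact hb _ ha

theorem IsLarge.exists_off (hB : IsLarge Bad) {Z : Set (ℕ → ℝ)} {n : ℕ} {r : ℝ}
    (hZ : Bad (Z ∩ {z | z n = r}ᶜ)) : ∃ δ > 0, Bad (Z ∩ {z | δ ≤ |z n - r|}) := by
  obtain ⟨k, hk⟩ := hB.exists_of_countable hZ (fun k : ℕ => {z | 1 / ((k : ℝ) + 1) ≤ |z n - r|})
    (fun z hz => by
      obtain ⟨k, hk⟩ := exists_nat_one_div_lt (abs_pos.2 (sub_ne_zero.2 hz.2))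
      exact mem_iUnion.2 ⟨k, hk.le⟩)
  exact ⟨_, Nat.one_div_pos_of_nat, hB.mono hk fun z hz => ⟨hz.1.1, hz.2⟩⟩

theorem IsLarge.separate_of_off (hB : IsLarge Bad) {Z W : Set (ℕ → ℝ)} {n : ℕ} {r : ℝ}
    (hr : ∀ ε > 0, Bad (Z ∩ {z | |z n - r| < ε})) (hW : Bad (W ∩ {z | z n = r}ᶜ)) :
    ∃ Z' ⊆ Z, ∃ W' ⊆ W, Bad Z' ∧ Bad W' ∧ ∃ δ > 0, ∀ z ∈ Z', ∀ w ∈ W', δ ≤ |z n - w n| := by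
  obtain ⟨δ, hδ, h⟩ := hB.exists_off hW
  refine ⟨_, inter_subset_left, _, inter_subset_left, hr (δ / 2) (half_pos hδ), h, δ / 2,
    half_pos hδ, ?_⟩
  rintro z ⟨-, hz⟩ w ⟨-, hw⟩
  have h1 : |z n - r| < δ / 2 := hz
  have h2 : δ ≤ |w n - r| := hw
  have h3 : |w n - r| ≤ |w n - z n| + |z n - r| := abs_sub_le _ _ _
  rw [abs_sub_comm (z n)]
  linarith

/-- Take a real `r` around which the `n`-th coordinate of `Z` concentrates. If one of the sets has a
large part off `r`, a smaller large part stays at positive distance from `r`, while the other set is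
large arbitrarily close to `r`. Otherwise both are large on `{z n = r}`. -/
theorem IsLarge.separate (hB : IsLarge Bad) {Z W : Set (ℕ → ℝ)} (hZ : Bad Z) (hW : Bad W)
    (n : ℕ) : ∃ Z' ⊆ Z, ∃ W' ⊆ W, Bad Z' ∧ Bad W' ∧
      ((∃ r, ∀ z ∈ Z' ∪ W', z n = r) ∨ ∃ δ > 0, ∀ z ∈ Z', ∀ w ∈ W', δ ≤ |z n - w n|) := by
  obtain ⟨r, hr⟩ := hB.exists_support hZ n
  rcases hB.inter_or_diff hW {z | z n = r} with h | h
  · rcases hB.inter_or_diff hZ {z | z n = r} with h' | h'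
    · refine ⟨_, inter_subset_left, _, inter_subset_left, h', h, Or.inl ⟨r, ?_⟩⟩
      rintro z (hz | hz)
      exacts [hz.2, hz.2]
    · have hr' : ∀ ε > 0, Bad (W ∩ {z | |z n - r| < ε}) := fun ε hε =>
        hB.mono h fun z hz => ⟨hz.1, by
          have : z n = r := hz.2
          simpa [this] using hε⟩
      obtain ⟨W', hW', Z', hZ', h1, h2, δ, hδ, h3⟩ := hB.separate_of_off hr' h'
      exact ⟨Z', hZ', W', hW', h2, h1, Or.inr ⟨δ, hδ, fun z hz w hw => by
        rw [abs_sub_comm]; exact h3 w hw z hz⟩⟩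
  · obtain ⟨Z', hZ', W', hW', h1, h2, h3⟩ := hB.separate_of_off hr h
    exact ⟨Z', hZ', W', hW', h1, h2, Or.inr h3⟩

/-- The coordinates below `k` are treated one at a time; smallness and the dichotomy pass to
subsets, so later shrinking does no harm. -/
theorem IsLarge.exists_split (hB : IsLarge Bad) {Z : Set (ℕ → ℝ)} (hZ : Bad Z) {ε : ℝ}
    (hε : 0 < ε) (k : ℕ) : ∃ W : Bool → Set (ℕ → ℝ), (∀ b, W b ⊆ Z ∧ Bad (W b)) ∧
      ∀ n < k, (∀ b, ∀ z ∈ W b, ∀ z' ∈ W b, |z n - z' n| ≤ ε) ∧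
        ((∃ r, ∀ b, ∀ z ∈ W b, z n = r) ∨
          ∃ δ > 0, ∀ z ∈ W true, ∀ z' ∈ W false, δ ≤ |z n - z' n|) := by
  induction k with
  | zero => exact ⟨fun _ => Z, fun _ => ⟨Subset.rfl, hZ⟩, by simp⟩
  | succ k ih =>
    obtain ⟨W, hW, hsep⟩ := ih
    obtain ⟨T, hT, F, hF, bT, bF, h⟩ := hB.separate (hW true).2 (hW false).2 k
    obtain ⟨T', hT', bT', sT⟩ := hB.exists_small bT k hε
    obtain ⟨F', hF', bF', sF⟩ := hB.exists_small bF k hε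
    refine ⟨fun b => if b then T' else F', ?_, ?_⟩
    · rintro (_ | _)
      · exact ⟨hF'.trans (hF.trans (hW false).1), bF'⟩
      · exact ⟨hT'.trans (hT.trans (hW true).1), bT'⟩
    · intro n hn
      have sub : ∀ b, (if b then T' else F') ⊆ W b := by
        rintro (_ | _)
        exacts [hF'.trans hF, hT'.trans hT]
      rcases Nat.lt_succ_iff_lt_or_eq.1 hn with hn | rfl
      · obtain ⟨h1, h2⟩ := hsep n hn
        refine ⟨fun b z hz z' hz' => h1 b z (sub b hz) z' (sub b hz'), ?_⟩
        rcases h2 with ⟨r, hr⟩ | ⟨δ, hδ, h2⟩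
        · exact Or.inl ⟨r, fun b z hz => hr b z (sub b hz)⟩
        · exact Or.inr ⟨δ, hδ, fun z hz z' hz' => h2 z (sub true hz) z' (sub false hz')⟩
      · refine ⟨?_, ?_⟩
        · rintro (_ | _)
          exacts [sF, sT]
        · rcases h with ⟨r, hr⟩ | ⟨δ, hδ, h2⟩
          · refine Or.inl ⟨r, ?_⟩
            rintro (_ | _) z hz
            exacts [hr z (Or.inr (hF' hz)), hr z (Or.inl (hT' hz))]
          · exact Or.inr ⟨δ, hδ, fun z hz z' hz' => h2 z (hT' hz) z' (hF' hz')⟩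

end Splitting

/-! ### Cantor schemes of large sets. -/

/-- The limits along the branch `t` of the coordinates of `c` which are never marked by `d`. -/
def limitSet (c : List Bool → ℕ → ℝ) (d : List Bool → ℕ → Prop) (t : ℕ → Bool) : Set ℝ :=
  {y | ∃ n, (∀ k, ¬ d (PiNat.res t k) n) ∧
    Filter.Tendsto (fun k => c (PiNat.res t k) n) Filter.atTop (𝓝 y)}

theorem limitSet_countable (c : List Bool → ℕ → ℝ) (d : List Bool → ℕ → Prop) (t : ℕ → Bool) :
    (limitSet c d t).Countable := by
  have : limitSet c d t ⊆ ⋃ n : ℕ,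
      {y | Filter.Tendsto (fun k => c (PiNat.res t k) n) Filter.atTop (𝓝 y)} := by
    rintro y ⟨n, -, h⟩
    exact mem_iUnion.2 ⟨n, h⟩
  refine (countable_iUnion fun n => Set.Subsingleton.countable ?_).mono this
  exact fun y hy y' hy' => tendsto_nhds_unique hy hy'

/-- A large family of sets contains a Cantor scheme whose branches converge, with coordinates
that are either eventually constant or injective along the scheme. -/
theorem IsLarge.exists_scheme {Bad : Set (ℕ → ℝ) → Prop} (hB : IsLarge Bad) (hu : Bad univ) :
    ∃ (c : List Bool → ℕ → ℝ) (d : List Bool → ℕ → Prop),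
      (∀ y, {t | y ∈ limitSet c d t}.Countable) ∧
      ∀ t, ∃ (x : ℕ → ℝ) (Z : ℕ → Set (ℕ → ℝ)), (∀ k, Bad (Z k)) ∧
        (∀ n, x n ∈ limitSet c d t ∨ ∀ᶠ k in Filter.atTop, ∀ z ∈ Z k, z n = x n) ∧
        ∀ n, ∀ U ∈ 𝓝 (x n), ∀ᶠ k in Filter.atTop, ∀ z ∈ Z k, z n ∈ U := by
  have hpow : ∀ k : ℕ, (0 : ℝ) < (1 / 2) ^ k := fun k => by positivity
  choose W hW hsep using fun (Z : {Z // Bad Z}) (k : ℕ) => hB.exists_split Z.2 (hpow k) k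
  -- A node at depth `k` is split with respect to its first `k` coordinates, with tolerance `2⁻ᵏ`.
  -- The newest digit is the head of the list, as in `PiNat.res`.
  let Y : List Bool → {Z // Bad Z} := fun l =>
    List.rec ⟨univ, hu⟩ (fun b l Z => ⟨W Z l.length b, (hW Z l.length b).2⟩) l
  have hY : ∀ b l, (Y (b :: l)).1 = W (Y l) l.length b := fun b l => rfl
  have hne : ∀ l, (Y l).1.Nonempty := fun l => by
    rw [nonempty_iff_ne_empty]
    intro h
    exact hB.not_empty (h ▸ (Y l).2)
  choose c hc using hne
  let d : List Bool → ℕ → Prop := fun l n => ∃ r, ∀ z ∈ (Y l).1, z n = r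
  have hlen : ∀ (t : ℕ → Bool) k, (PiNat.res t k).length = k := fun t k => PiNat.res_length t k
  have hsucc : ∀ (t : ℕ → Bool) k,
      (Y (PiNat.res t (k + 1))).1 = W (Y (PiNat.res t k)) k (t k) := by
    intro t k
    rw [PiNat.res_succ, hY, hlen]
  have hanti : ∀ t : ℕ → Bool, Antitone fun k => (Y (PiNat.res t k)).1 := by
    intro t
    refine antitone_nat_of_succ_le fun k => ?_
    rw [hsucc]
    exact (hW _ _ _).1
  have hmem : ∀ (t : ℕ → Bool) {k j : ℕ}, k ≤ j → c (PiNat.res t j) ∈ (Y (PiNat.res t k)).1 :=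
    fun t k j h => hanti t h (hc _)
  refine ⟨c, d, fun y => ?_, fun t => ?_⟩
  -- Once `n` and the first `n + 1` digits are fixed, only one branch can qualify: two branches
  -- parting at a level `k > n` have their `n`-th coordinates separated by some `δ`, unless that
  -- coordinate has become constant, which would be marked by `d`.
  · have hcov : {t | y ∈ limitSet c d t} ⊆ ⋃ (n : ℕ) (l : List Bool),
        {t | PiNat.res t (n + 1) = l ∧ (∀ k, ¬ d (PiNat.res t k) n) ∧
          Filter.Tendsto (fun k => c (PiNat.res t k) n) Filter.atTop (𝓝 y)} := by
      rintro t ⟨n, h1, h2⟩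
      exact mem_iUnion₂.2 ⟨n, _, rfl, h1, h2⟩
    refine (countable_iUnion fun n => countable_iUnion fun l =>
      Set.Subsingleton.countable ?_).mono hcov
    have key : ∀ t t' : ℕ → Bool, ∀ k, n < k → PiNat.res t k = PiNat.res t' k → t k = true →
        t' k = false → (∀ k, ¬ d (PiNat.res t k) n) →
        Filter.Tendsto (fun k => c (PiNat.res t k) n) Filter.atTop (𝓝 y) →
        Filter.Tendsto (fun k => c (PiNat.res t' k) n) Filter.atTop (𝓝 y) → False := by
      intro t t' k hk hres ht ht' hd h1 h2
      have e1 := hsucc t k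
      have e2 := hsucc t' k
      rw [ht] at e1
      rw [ht', ← hres] at e2
      rcases (hsep (Y (PiNat.res t k)) k n hk).2 with ⟨r, hr⟩ | ⟨δ, hδ, h⟩
      · refine hd (k + 1) ⟨r, fun z hz => hr true z ?_⟩
        rwa [← e1]
      · have hlim : Filter.Tendsto (fun k => |c (PiNat.res t k) n - c (PiNat.res t' k) n|)
            Filter.atTop (𝓝 |y - y|) := (h1.sub h2).abs
        have : δ ≤ |y - y| := by
          refine ge_of_tendsto hlim ?_
          filter_upwards [Filter.eventually_ge_atTop (k + 1)] with j hj
          refine h _ ?_ _ ?_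
          · rw [← e1]; exact hmem t hj
          · rw [← e2]; exact hmem t' hj
        simp at this
        linarith
    rintro t ⟨hl, hd, ht⟩ t' ⟨hl', hd', ht'⟩
    by_contra hne
    have hex : ∃ k, t k ≠ t' k := Function.ne_iff.1 hne
    classical
    have hk := Nat.find_spec hex
    have hmin : ∀ m < Nat.find hex, t m = t' m := fun m hm => by
      simpa using Nat.find_min hex hm
    set k := Nat.find hex
    have hres : PiNat.res t k = PiNat.res t' k := PiNat.res_eq_res.2 fun m hm => hmin m hm
    have hnk : n < k := by
      by_contra! h
      exact hk (PiNat.res_eq_res.1 (hl.trans hl'.symm) (Nat.lt_succ_of_le h))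
    cases htk : t k <;> cases htk' : t' k
    · exact hk (htk.trans htk'.symm)
    · exact key t' t k hnk hres.symm htk' htk hd' ht' ht
    · exact key t t' k hnk hres htk htk' hd ht ht'
    · exact hk (htk.trans htk'.symm)
  · have hdiam : ∀ n k, n < k → ∀ z ∈ (Y (PiNat.res t (k + 1))).1,
        ∀ z' ∈ (Y (PiNat.res t (k + 1))).1, |z n - z' n| ≤ (1 / 2) ^ k := by
      intro n k hnk
      rw [hsucc]
      exact (hsep (Y (PiNat.res t k)) k n hnk).1 (t k)
    have hp0 : Filter.Tendsto (fun k : ℕ => ((1 : ℝ) / 2) ^ k) Filter.atTop (𝓝 0) :=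
      tendsto_pow_atTop_nhds_zero_of_lt_one (by norm_num) (by norm_num)
    have hlim : ∀ n, ∃ y, Filter.Tendsto (fun k => c (PiNat.res t k) n) Filter.atTop (𝓝 y) := by
      intro n
      refine cauchySeq_tendsto_of_complete (Metric.cauchySeq_iff'.2 fun ε hε => ?_)
      obtain ⟨k, hk, hnk⟩ := ((hp0.eventually (gt_mem_nhds hε)).and
        (Filter.eventually_gt_atTop n)).exists
      refine ⟨k + 1, fun j hj => ?_⟩
      rw [Real.dist_eq]
      exact (hdiam n k hnk _ (hmem t hj) _
        (hmem t (le_refl (k + 1)))).trans_lt hk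
    choose x hx using hlim
    have hxclose : ∀ n k, n < k → ∀ z ∈ (Y (PiNat.res t (k + 1))).1, |z n - x n| ≤ (1 / 2) ^ k := by
      intro n k hnk z hz
      refine le_of_tendsto ((hx n).const_sub (z n)).abs ?_
      filter_upwards [Filter.eventually_ge_atTop (k + 1)] with j hj
      exact hdiam n k hnk z hz _ (hmem t hj)
    refine ⟨x, fun k => (Y (PiNat.res t k)).1, fun k => (Y _).2, fun n => ?_, fun n U hU => ?_⟩
    -- A coordinate never marked contributes its limit to `limitSet`; a marked one is constant from
    -- that node on.
    · by_cases h : ∀ k, ¬ d (PiNat.res t k) n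
      · exact Or.inl ⟨n, h, hx n⟩
      · push Not at h
        obtain ⟨k, r, hr⟩ := h
        right
        have hxr : x n = r := by
          refine tendsto_nhds_unique (hx n) (tendsto_const_nhds.congr' ?_)
          filter_upwards [Filter.eventually_ge_atTop k] with j hj
          exact (hr _ (hmem t hj)).symm
        filter_upwards [Filter.eventually_ge_atTop k] with j hj z hz
        rw [hxr]
        exact hr z (hanti t hj hz)
    · obtain ⟨ε, hε, hball⟩ := Metric.mem_nhds_iff.1 hU
      obtain ⟨k, hk, hnk⟩ := ((hp0.eventually (gt_mem_nhds hε)).and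
        (Filter.eventually_gt_atTop n)).exists
      filter_upwards [Filter.eventually_ge_atTop (k + 1)] with j hj z hz
      refine hball ?_
      rw [Metric.mem_ball, Real.dist_eq]
      exact (hxclose n k hnk z (hanti t hj hz)).trans_lt hk

/-! ### Lindelöf powers of the modified line and the existence of the partition. -/

theorem SpI.exists_ball_subset {X A : Set ℝ} {U : Set (SpI X A)} (hU : IsOpen U) :
    ∀ x : X, (x : ℝ) ∈ A → (x : SpI X A) ∈ U →
      ∃ V ∈ 𝓝 (x : ℝ), ∀ y : X, (y : ℝ) ∈ V → (y : SpI X A) ∈ U := by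
  intro x hx hxU
  induction hU with
  | basic s hs =>
    rcases hs with hs | ⟨y, hy, rfl⟩
    · obtain ⟨V, hV, h⟩ := mem_nhds_subtype X x s |>.1 (IsOpen.mem_nhds (X := X) hs hxU)
      exact ⟨V, hV, fun y hy => h hy⟩
    · have : x = y := hxU
      exact absurd (this ▸ hx) hy
  | univ => exact ⟨univ, Filter.univ_mem, fun _ _ => trivial⟩
  | inter s t _ _ h1 h2 =>
    obtain ⟨V, hV, h⟩ := h1 hxU.1
    obtain ⟨V', hV', h'⟩ := h2 hxU.2
    exact ⟨V ∩ V', Filter.inter_mem hV hV', fun y hy => ⟨h y hy.1, h' y hy.2⟩⟩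
  | sUnion S _ ih =>
    obtain ⟨s, hs, hxs⟩ := hxU
    obtain ⟨V, hV, h⟩ := ih s hs hxs
    exact ⟨V, hV, fun y hy => ⟨s, hs, h y hy⟩⟩

/-- Large means not covered by countably many members of the cover. A branch with limits in `M`
leads to a member containing the limit sequence; a basic neighbourhood inside it restricts finitely
many coordinates, each of which is either eventually constant or has its limit in `M`, where
neighbourhoods are Euclidean. So one member covers a large node. -/
theorem lindelof_of_limitSet_subset (M : Set ℝ)
    (hM : ∀ c d, (∀ y, {t | y ∈ limitSet c d t}.Countable) → ∃ t, limitSet c d t ⊆ M) :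
    LindelofToCountableDegree (SpI univ M) := by
  refine ⟨isLindelof_iff_countable_subcover.2 fun {κ} U hUo hcov => ?_⟩
  let e : (ℕ → ℝ) → (ℕ → SpI univ M) := fun z n => (⟨z n, trivial⟩ : (univ : Set ℝ))
  let Bad : Set (ℕ → ℝ) → Prop := fun Z => ¬ ∃ s : Set κ, s.Countable ∧ ∀ z ∈ Z, ∃ i ∈ s, e z ∈ U i
  have hB : IsLarge Bad :=
    { not_empty := fun h => h ⟨∅, countable_empty, by simp⟩
      mono := fun {Z W} hZ hZW ⟨s, hs, h⟩ => hZ ⟨s, hs, fun z hz => h z (hZW hz)⟩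
      iUnion := fun {Z} hZ => by
        by_contra! h
        simp only [Bad, not_not] at h
        choose s hs h using h
        refine hZ ⟨⋃ k, s k, countable_iUnion hs, fun z hz => ?_⟩
        obtain ⟨k, hk⟩ := mem_iUnion.1 hz
        obtain ⟨i, hi, hzi⟩ := h k z hk
        exact ⟨i, mem_iUnion.2 ⟨k, hi⟩, hzi⟩ }
  by_cases hu : Bad univ
  · exfalso
    obtain ⟨c, d, hcd, hlim⟩ := hB.exists_scheme hu
    obtain ⟨t, ht⟩ := hM c d hcd
    obtain ⟨x, Z, hZ, hx, hnear⟩ := hlim t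
    obtain ⟨i, hi⟩ := mem_iUnion.1 (hcov (mem_univ (e x)))
    obtain ⟨F, u, hu, hsub⟩ := isOpen_pi_iff.1 (hUo i) (e x) hi
    have hev : ∀ n ∈ F, ∀ᶠ k in Filter.atTop, ∀ z ∈ Z k, e z n ∈ u n := by
      intro n hn
      rcases hx n with h | h
      · obtain ⟨V, hV, h'⟩ := SpI.exists_ball_subset (hu n hn).1 ⟨x n, trivial⟩ (ht h) (hu n hn).2
        filter_upwards [hnear n V hV] with k hk z hz
        exact h' _ (hk z hz)
      · filter_upwards [h] with k hk z hz
        have : e z n = e x n := Subtype.ext (hk z hz)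
        rw [this]
        exact (hu n hn).2
    obtain ⟨k, hk⟩ := ((Filter.eventually_all_finset F).2 hev).exists
    exact hZ k ⟨{i}, countable_singleton i, fun z hz => ⟨i, rfl, hsub fun n hn => hk n hn z hz⟩⟩
  · simp only [Bad, not_not] at hu
    obtain ⟨s, hs, h⟩ := hu
    refine ⟨s, hs, fun z _ => ?_⟩
    obtain ⟨i, hi, hz⟩ := h (fun n => (z n : (univ : Set ℝ)).1) trivial
    exact mem_biUnion hi hz

theorem SpI.isOpen_singleton {X A : Set ℝ} {x : X} (hx : (x : ℝ) ∉ A) :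
    IsOpen (X := SpI X A) ({x} : Set X) :=
  TopologicalSpace.isOpen_generateFrom_of_mem (Or.inr ⟨x, hx, rfl⟩)

theorem SpI.isOpen_of_isOpen {X A : Set ℝ} {U : Set X} (hU : IsOpen U) :
    IsOpen (X := SpI X A) U :=
  TopologicalSpace.isOpen_generateFrom_of_mem (Or.inl hU)

/-- The inclusion into the line. -/
def SpI.val {X A : Set ℝ} (x : SpI X A) : ℝ := Subtype.val (p := (· ∈ X)) x

theorem SpI.continuous_val {X A : Set ℝ} : Continuous (SpI.val (X := X) (A := A)) :=
  ⟨fun U hU => SpI.isOpen_of_isOpen (X := X) (U := Subtype.val ⁻¹' U)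
    (hU.preimage continuous_subtype_val)⟩

theorem lindelofSpace_of_countableDegree {X : Type} [TopologicalSpace X]
    (h : LindelofToCountableDegree X) : LindelofSpace X :=
  @LindelofSpace.of_continuous_surjective (ℕ → X) X _ _ (fun z => z 0) h (continuous_apply 0)
    fun x => ⟨fun _ => x, rfl⟩

/-- Such a set is closed and discrete in a Lindelöf space. -/
theorem countable_of_isClosed_disjoint {M : Set ℝ} (h : LindelofToCountableDegree (SpI univ M))
    {K : Set ℝ} (hK : IsClosed K) (hKM : Disjoint K M) : K.Countable := by
  have := lindelofSpace_of_countableDegree h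
  let K' : Set (SpI univ M) := SpI.val ⁻¹' K
  have hK' : IsClosed K' := hK.preimage SpI.continuous_val
  have hd : DiscreteTopology K' := by
    refine discreteTopology_iff_isOpen_singleton.2 fun x => ?_
    have : ({x} : Set K') = Subtype.val ⁻¹' ({x.1} : Set (SpI univ M)) := by
      ext y; simp [Subtype.ext_iff]
    rw [this]
    exact IsOpen.preimage continuous_subtype_val
      (SpI.isOpen_singleton (Set.disjoint_left.1 hKM (show SpI.val x.1 ∈ K from x.2)))
  have hc := hK'.isLindelof.countable hd
  refine (hc.image SpI.val).mono fun x hx => ?_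
  exact ⟨(⟨x, trivial⟩ : (univ : Set ℝ)), hx, rfl⟩

theorem exists_mem_Ioo_of_lindelof {M : Set ℝ} (h : LindelofToCountableDegree (SpI univ M))
    {a b : ℝ} (hab : a < b) : ∃ x ∈ M, a < x ∧ x < b := by
  by_contra! hM
  obtain ⟨a', h1, h2⟩ := exists_between hab
  obtain ⟨b', h3, h4⟩ := exists_between h2
  have := countable_of_isClosed_disjoint h (isClosed_Icc (a := a') (b := b'))
    (Set.disjoint_left.2 fun x hx hxM => absurd (hM x hxM (h1.trans_le hx.1))
      (not_le.2 (hx.2.trans_lt h4)))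
  rw [← Cardinal.le_aleph0_iff_set_countable, Cardinal.mk_Icc_real h3] at this
  exact Cardinal.aleph0_lt_continuum.not_ge this

/-- There are at most `𝔠` admissible schemes, so the colouring lemma applies with the reals as
colours and the branches as indices. -/
theorem exists_okunevTamanoPartition :
    ∃ (ι : Type) (M : ι → Set ℝ), IsOkunevTamanoPartition M := by
  let K := {p : (List Bool → ℕ → ℝ) × (List Bool → ℕ → Prop) //
    ∀ y, {t | y ∈ limitSet p.1 p.2 t}.Countable}
  have hK : #K ≤ 𝔠 := by
    refine (Cardinal.mk_subtype_le _).trans ?_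
    simp [Cardinal.mk_real, Cardinal.continuum_power_aleph0, Cardinal.continuum_mul_self]
  obtain ⟨m, hm⟩ := exists_coloring (ι := ℝ) (K := K) (T := ℕ → Bool) (E := ℝ)
    Cardinal.mk_real.le hK (by simp) (fun k t => limitSet k.1.1 k.1.2 t)
    (fun k t => limitSet_countable _ _ t) (fun k y => k.2 y)
  have hL : ∀ i, LindelofToCountableDegree (SpI univ (m ⁻¹' {i})) := fun i =>
    lindelof_of_limitSet_subset _ fun c d h => (hm i ⟨(c, d), h⟩).imp fun t ht y hy => ht y hy
  refine ⟨ℝ, fun i => m ⁻¹' {i}, Cardinal.mk_real, fun i => ?_, fun i j hij => ?_, ?_, hL⟩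
  · obtain ⟨x, hx, -⟩ := exists_mem_Ioo_of_lindelof (hL i) zero_lt_one
    exact ⟨x, hx⟩
  · exact Disjoint.preimage m (disjoint_singleton.2 hij)
  · exact eq_univ_of_forall fun x => mem_iUnion.2 ⟨m x, rfl⟩

/-! ### Free Boolean topological groups -/

namespace FreeBooleanGroup

universe u v

variable {X : Type u} {Y : Type v}

theorem induction {p : FreeBooleanGroup X → Prop} (zero : p 0)
    (add : ∀ x g, p g → p (of x + g)) (g : FreeBooleanGroup X) : p g := by
  refine Finsupp.induction (motive := p) g zero fun x b f _ hb hf => ?_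
  have : b = 1 := by
    revert hb; revert b; decide
  subst this
  exact add x f hf

theorem hom_ext {K : Type*} [AddZeroClass K] {φ ψ : FreeBooleanGroup X →+ K}
    (h : ∀ x, φ (of x) = ψ (of x)) : φ = ψ := by
  ext g
  induction g using FreeBooleanGroup.induction with
  | zero => simp
  | add x g ih => rw [map_add, map_add, ih, h]

theorem continuous_of [TopologicalSpace X] : Continuous (of : X → FreeBooleanGroup X) := by
  refine continuous_sInf_rng.2 ?_
  rintro _ ⟨t, ht, rfl⟩
  exact ht

/-- The topology induced by `φ` is one of the group topologies over which the infimum is taken. -/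
theorem continuous_of_continuous_comp_of [TopologicalSpace X] {K : Type*} [AddGroup K]
    [TopologicalSpace K] [IsTopologicalAddGroup K] (φ : FreeBooleanGroup X →+ K)
    (h : Continuous fun x => φ (of x)) : Continuous φ := by
  let t : AddGroupTopology (FreeBooleanGroup X) :=
    { toTopologicalSpace := TopologicalSpace.induced φ inferInstance
      toIsTopologicalAddGroup := topologicalAddGroup_induced φ }
  have ht : groupTopology X ≤ t := sInf_le (continuous_induced_rng.2 h)
  exact continuous_iff_le_induced.2 ht

/-- The homomorphism of free Boolean groups which extends a map of the bases. -/
noncomputable def map (e : X → Y) : FreeBooleanGroup X →+ FreeBooleanGroup Y :=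
  (Finsupp.mapDomain.addMonoidHom e : (X →₀ ZMod 2) →+ (Y →₀ ZMod 2))

@[simp] theorem map_of (e : X → Y) (x : X) : map e (of x) = of (e x) :=
  Finsupp.mapDomain_single

theorem continuous_map [TopologicalSpace X] [TopologicalSpace Y] {e : X → Y} (he : Continuous e) :
    Continuous (map e) :=
  continuous_of_continuous_comp_of _ ((continuous_of.comp he).congr fun x => (map_of e x).symm)

open Classical in
/-- The parity of the intersection of an element of the free Boolean group with a set. -/
noncomputable def mass (S : Set X) : FreeBooleanGroup X →+ ZMod 2 :=
  (Finsupp.liftAddHom fun x => if x ∈ S then AddMonoidHom.id (ZMod 2) else 0 :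
    (X →₀ ZMod 2) →+ ZMod 2)

theorem mass_of_mem {S : Set X} {x : X} (h : x ∈ S) : mass S (of x) = 1 := by
  refine (Finsupp.liftAddHom_apply_single _ _ _).trans ?_
  simp [h]

theorem mass_of_notMem {S : Set X} {x : X} (h : x ∉ S) : mass S (of x) = 0 := by
  refine (Finsupp.liftAddHom_apply_single _ _ _).trans ?_
  simp [h]

theorem mass_map (e : X → Y) (S : Set Y) (g : FreeBooleanGroup X) :
    mass S (map e g) = mass (e ⁻¹' S) g := by
  have : (mass S).comp (map e) = mass (e ⁻¹' S) := by
    refine hom_ext fun x => ?_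
    by_cases h : e x ∈ S
    · rw [AddMonoidHom.comp_apply, map_of, mass_of_mem h, mass_of_mem (show x ∈ e ⁻¹' S from h)]
    · rw [AddMonoidHom.comp_apply, map_of, mass_of_notMem h,
        mass_of_notMem (show x ∉ e ⁻¹' S from h)]
  exact DFunLike.congr_fun this g

theorem mass_inter_add_diff (S T : Set X) (g : FreeBooleanGroup X) :
    mass (S ∩ T) g + mass (S \ T) g = mass S g := by
  have : mass (S ∩ T) + mass (S \ T) = mass S := by
    refine hom_ext fun x => ?_
    rw [AddMonoidHom.add_apply]
    by_cases h : x ∈ S <;> by_cases h' : x ∈ T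
    · rw [mass_of_mem (mem_inter h h'), mass_of_notMem (fun H : x ∈ S \ T => H.2 h'),
        mass_of_mem h, add_zero]
    · rw [mass_of_notMem (fun H : x ∈ S ∩ T => h' H.2), mass_of_mem (show x ∈ S \ T from ⟨h, h'⟩),
        mass_of_mem h, zero_add]
    all_goals
      rw [mass_of_notMem (fun H : x ∈ S ∩ T => h H.1), mass_of_notMem (fun H : x ∈ S \ T => h H.1),
        mass_of_notMem h, add_zero]
  exact DFunLike.congr_fun this g

/-- The elements of the finite set `g`. -/
def supp (g : FreeBooleanGroup X) : Finset X := Finsupp.support (M := ZMod 2) g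

theorem mass_eq_zero {S : Set X} {g : FreeBooleanGroup X} (h : ∀ x ∈ supp g, x ∉ S) :
    mass S g = 0 := by
  refine (Finsupp.liftAddHom_apply _ _).trans (Finset.sum_eq_zero fun x hx => ?_)
  simp [h x hx]

theorem mass_eq_one {S : Set X} {g : FreeBooleanGroup X} {x : X} (hx : x ∈ supp g) (hxS : x ∈ S)
    (h : ∀ y ∈ supp g, y ∈ S → y = x) : mass S g = 1 := by
  refine (Finsupp.liftAddHom_apply _ _).trans ((Finset.sum_eq_single x ?_ ?_).trans ?_)
  · intro y hy hyx
    have : y ∉ S := fun H => hyx (h y hy H)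
    simp [this]
  · intro H; exact absurd hx H
  · have h0 : Finsupp.toFun (M := ZMod 2) g x ≠ 0 := Finsupp.mem_support_iff.1 hx
    have : ∀ b : ZMod 2, b ≠ 0 → b = 1 := by decide
    simp only [hxS, if_true]
    exact this _ h0

/-- `B(X)` maps continuously to the free Boolean group on the pieces with the discrete topology.
Thus the parities on all pieces of an open partition, even an infinite one, are locally constant
simultaneously. -/
theorem isOpen_map_preimage [TopologicalSpace X] {e : X → Y} (he : ∀ y, IsOpen (e ⁻¹' {y}))
    (Q : Set (FreeBooleanGroup Y)) : IsOpen (map e ⁻¹' Q) := by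
  let K := Y →₀ ZMod 2
  let _ : TopologicalSpace K := ⊥
  have _ : DiscreteTopology K := ⟨rfl⟩
  have _ : IsTopologicalAddGroup K := {}
  let φ : FreeBooleanGroup X →+ K := map e
  have hφ : Continuous φ := by
    refine continuous_of_continuous_comp_of φ (continuous_discrete_rng.2 fun k => ?_)
    have : (fun x => φ (of x)) ⁻¹' {k} = ⋃ y ∈ {y : Y | (of y : FreeBooleanGroup Y) = k},
        e ⁻¹' {y} := by
      ext x
      simp only [mem_preimage, mem_singleton_iff, mem_iUnion, exists_prop]
      exact ⟨fun h => ⟨_, (map_of e x).symm.trans h, rfl⟩, fun ⟨y, h, h'⟩ =>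
        (map_of e x).trans (h' ▸ h)⟩
    rw [this]
    exact isOpen_biUnion fun y _ => he y
  have hQ : IsOpen (X := K) Q := isOpen_discrete _
  exact hQ.preimage hφ

theorem eventually_map_eq [TopologicalSpace X] {e : X → Y} (he : ∀ y, IsOpen (e ⁻¹' {y}))
    (g : FreeBooleanGroup X) : ∀ᶠ g' in 𝓝 g, map e g' = map e g :=
  (isOpen_map_preimage he {map e g}).mem_nhds rfl

theorem eventually_mass_eq [TopologicalSpace X] {S : Set X} (hS : IsClopen S)
    (g : FreeBooleanGroup X) : ∀ᶠ g' in 𝓝 g, mass S g' = mass S g := by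
  have he : ∀ y : Prop, IsOpen ((fun x => x ∈ S) ⁻¹' {y}) := by
    intro y
    by_cases hy : y
    · convert hS.isOpen using 1; ext x; simp [hy]
    · convert hS.compl.isOpen using 1; ext x; simp [hy]
  filter_upwards [eventually_map_eq he g] with g' hg'
  have key : ∀ g'', mass S g'' = mass {True} (map (fun x => x ∈ S) g'') := by
    intro g''
    rw [mass_map]
    congr 1
    ext x; simp
  rw [key, key, hg']

theorem exists_sum_eq [Nonempty X] (g : FreeBooleanGroup X) :
    ∃ (m : ℕ) (x : ℕ → X), ∑ i ∈ Finset.range m, of (x i) = g := by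
  induction g using FreeBooleanGroup.induction with
  | zero => exact ⟨0, fun _ => Classical.arbitrary X, by simp⟩
  | add a g ih =>
    obtain ⟨m, x, h⟩ := ih
    refine ⟨m + 1, fun i => Nat.casesOn i a x, ?_⟩
    rw [Finset.sum_range_succ', add_comm]
    exact congrArg (of a + ·) h

theorem separableSpace [TopologicalSpace X] [TopologicalSpace.SeparableSpace X] :
    TopologicalSpace.SeparableSpace (FreeBooleanGroup X) := by
  obtain ⟨s, hs, hd⟩ := TopologicalSpace.exists_countable_dense X
  have := hs.to_subtype
  let R := (map (Subtype.val : s → X)).range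
  have : Countable (FreeBooleanGroup s) := inferInstanceAs (Countable (s →₀ ZMod 2))
  have hR : (R : Set (FreeBooleanGroup X)).Countable := countable_range _
  refine ⟨R, hR, fun g => ?_⟩
  have hmem : ∀ x, of x ∈ R.topologicalClosure := by
    intro x
    have h1 : of '' s ⊆ (R : Set (FreeBooleanGroup X)) := by
      rintro _ ⟨x, hx, rfl⟩
      exact ⟨of ⟨x, hx⟩, map_of _ _⟩
    exact closure_mono h1 (image_closure_subset_closure_image continuous_of ⟨x, hd x, rfl⟩)
  change g ∈ R.topologicalClosure
  induction g using FreeBooleanGroup.induction with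
  | zero => exact zero_mem _
  | add x g ih => exact add_mem (hmem x) ih

/-! #### Cells of a separating sequence of cuts, and roots -/

/-- The points which are not separated from `x` by the first `n` cuts. -/
def cell (ψ : X → ℕ → Prop) (n : ℕ) (x : X) : Set X := {y | ∀ k < n, (ψ y k ↔ ψ x k)}

variable {ψ : X → ℕ → Prop}

theorem mem_cell_self (n : ℕ) (x : X) : x ∈ cell ψ n x := fun _ _ => Iff.rfl

theorem cell_zero (x : X) : cell ψ 0 x = Set.univ := by ext; simp [cell]

theorem cell_eq_of_mem {n : ℕ} {x y : X} (h : y ∈ cell ψ n x) : cell ψ n y = cell ψ n x := by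
  ext z
  exact forall₂_congr fun k hk => by rw [h k hk]

theorem cell_anti {n m : ℕ} (h : n ≤ m) (x : X) : cell ψ m x ⊆ cell ψ n x :=
  fun _ hy k hk => hy k (hk.trans_le h)

theorem mem_cell_succ_iff {n : ℕ} {x y : X} :
    y ∈ cell ψ (n + 1) x ↔ y ∈ cell ψ n x ∧ (ψ y n ↔ ψ x n) := by
  simp only [cell, mem_ofPred_eq, Nat.lt_succ_iff_lt_or_eq, or_imp, forall_and, forall_eq]

theorem cell_succ_eq_diff {n : ℕ} {x y : X} (h : y ∈ cell ψ n x) (h' : y ∉ cell ψ (n + 1) x) :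
    cell ψ (n + 1) y = cell ψ n x \ cell ψ (n + 1) x := by
  have h2 : ¬ (ψ y n ↔ ψ x n) := fun H => h' (mem_cell_succ_iff.2 ⟨h, H⟩)
  ext z
  rw [mem_sdiff, mem_cell_succ_iff, mem_cell_succ_iff, cell_eq_of_mem h]
  tauto

theorem exists_separating_cell (hψ : Function.Injective ψ) {x y : X} (h : y ≠ x) :
    ∃ n, y ∈ cell ψ n x ∧ y ∉ cell ψ (n + 1) x := by
  classical
  have hex : ∃ n, ¬ (ψ y n ↔ ψ x n) := by
    by_contra! H
    exact h (hψ (funext fun n => propext (H n)))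
  refine ⟨Nat.find hex, fun k hk => not_not.1 (Nat.find_min hex hk), fun H => ?_⟩
  exact Nat.find_spec hex (H _ (Nat.lt_succ_self _))

theorem exists_isolating_cell (hψ : Function.Injective ψ) (F : Finset X) (x : X) :
    ∃ n, ∀ y ∈ F, y ∈ cell ψ n x → y = x := by
  have : ∀ y ∈ F, ∀ᶠ n in Filter.atTop, y ∈ cell ψ n x → y = x := by
    intro y _
    by_cases h : y = x
    · exact Filter.Eventually.of_forall fun _ _ => h
    · obtain ⟨n, -, hn⟩ := exists_separating_cell hψ h
      filter_upwards [Filter.eventually_ge_atTop (n + 1)] with m hm H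
      exact absurd (cell_anti hm x H) hn
  exact ((Filter.eventually_all_finset F).2 this).exists

theorem isClopen_cell [TopologicalSpace X] (hc : ∀ k, IsClopen {y | ψ y k}) (n : ℕ) (x : X) :
    IsClopen (cell ψ n x) := by
  induction n with
  | zero => rw [cell_zero]; exact isClopen_univ
  | succ n ih =>
    have : cell ψ (n + 1) x = cell ψ n x ∩ {y | ψ y n ↔ ψ x n} := by
      ext y; exact mem_cell_succ_iff
    rw [this]
    refine ih.inter ?_
    by_cases h : ψ x n
    · simpa [h] using hc n
    · convert (hc n).compl using 1
      ext y
      simp [h]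

/-- A cell isolating one letter of `g' - g` has different parities on `g` and `g'`, and parity on a
clopen set is locally constant. -/
theorem t1Space [TopologicalSpace X] (hψ : Function.Injective ψ)
    (hc : ∀ k, IsClopen {y | ψ y k}) : T1Space (FreeBooleanGroup X) := by
  refine t1Space_iff_exists_open.2 fun g g' hne => ?_
  have hne' : supp (g' - g) ≠ ∅ := fun H => hne (sub_eq_zero.1 (Finsupp.support_eq_empty.1 H)).symm
  obtain ⟨x, hx⟩ := Finset.nonempty_iff_ne_empty.2 hne'
  obtain ⟨n, hn⟩ := exists_isolating_cell hψ (supp (g' - g)) x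
  have h1 := mass_eq_one hx (mem_cell_self n x) hn
  obtain ⟨U, hU, hUo, hgU⟩ := eventually_nhds_iff.1 (eventually_mass_eq (isClopen_cell hc n x) g)
  refine ⟨U, hUo, hgU, fun H => ?_⟩
  rw [map_sub, hU g' H, sub_self] at h1
  exact zero_ne_one h1

/-- `x` is the root of `g`: all cells of `x` contain an odd number of elements of `g`. -/
def IsRoot (ψ : X → ℕ → Prop) (g : FreeBooleanGroup X) (x : X) : Prop :=
  ∀ n, mass (cell ψ n x) g = 1

theorem IsRoot.odd {g : FreeBooleanGroup X} {x : X} (h : IsRoot ψ g x) : mass Set.univ g = 1 := by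
  rw [← cell_zero (ψ := ψ) x, h]

theorem isRoot_of (x : X) : IsRoot ψ (of x) x := fun n => mass_of_mem (mem_cell_self n x)

/-- An odd cell splits into an odd and an even half, so two descending chains of odd cells never
part. This gives uniqueness of roots. -/
theorem mem_cell_of_mass_eq_one {g : FreeBooleanGroup X} {x y : X} {n : ℕ}
    (hx : ∀ k ≤ n, mass (cell ψ k x) g = 1) (hy : ∀ k ≤ n, mass (cell ψ k y) g = 1) :
    y ∈ cell ψ n x := by
  induction n with
  | zero => rw [cell_zero]; trivial
  | succ n ih =>
    have hn := ih (fun k hk => hx k (hk.trans n.le_succ)) fun k hk => hy k (hk.trans n.le_succ)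
    by_contra h
    have h1 := mass_inter_add_diff (cell ψ n x) (cell ψ (n + 1) x) g
    rw [inter_eq_right.2 (cell_anti n.le_succ x), ← cell_succ_eq_diff hn h, hx _ le_rfl,
      hy _ le_rfl, hx _ n.le_succ] at h1
    exact absurd h1 (by decide)

theorem IsRoot.eq (hψ : Function.Injective ψ) {g : FreeBooleanGroup X} {x y : X}
    (hx : IsRoot ψ g x) (hy : IsRoot ψ g y) : x = y := by
  by_contra h
  obtain ⟨n, -, hn⟩ := exists_separating_cell hψ h
  exact hn (mem_cell_of_mass_eq_one (fun k _ => hy k) fun k _ => hx k)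

/-- Starting from the whole space, pass repeatedly to the odd half, which contains a letter of `g`.
-/
theorem exists_isRoot (hψ : Function.Injective ψ) {g : FreeBooleanGroup X}
    (hg : mass Set.univ g = 1) : ∃ x, IsRoot ψ g x := by
  have step : ∀ n, ∃ x ∈ supp g, ∀ k ≤ n, mass (cell ψ k x) g = 1 := by
    have hsupp : ∀ S : Set X, mass S g = 1 → ∃ x ∈ supp g, x ∈ S := by
      intro S hS
      by_contra! h
      exact zero_ne_one ((mass_eq_zero h).symm.trans hS)
    intro n
    induction n with
    | zero =>
      obtain ⟨x, hx, -⟩ := hsupp _ hg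
      refine ⟨x, hx, fun k hk => ?_⟩
      rw [Nat.le_zero.1 hk, cell_zero, hg]
    | succ n ih =>
      obtain ⟨x, hx, hxn⟩ := ih
      by_cases h : mass (cell ψ (n + 1) x) g = 1
      · refine ⟨x, hx, fun k hk => ?_⟩
        rcases Nat.le_succ_iff.1 hk with hk | rfl
        exacts [hxn k hk, h]
      · have h1 := mass_inter_add_diff (cell ψ n x) (cell ψ (n + 1) x) g
        rw [inter_eq_right.2 (cell_anti n.le_succ x), hxn n le_rfl] at h1
        have h2 : mass (cell ψ n x \ cell ψ (n + 1) x) g = 1 := by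
          generalize mass (cell ψ (n + 1) x) g = a at *
          generalize mass (cell ψ n x \ cell ψ (n + 1) x) g = b at *
          revert a b; decide
        obtain ⟨y, hy, hyn, hyn'⟩ := hsupp _ h2
        refine ⟨y, hy, fun k hk => ?_⟩
        rcases Nat.le_succ_iff.1 hk with hk | rfl
        · rw [cell_eq_of_mem (cell_anti hk x hyn), hxn k hk]
        · rw [cell_succ_eq_diff hyn hyn', h2]
  choose x hx hxn using step
  -- At this depth the cells separate the letters of `g`, so the letter found there is alone in all
  -- smaller cells and remains odd.
  obtain ⟨n, hn⟩ : ∃ n, ∀ z ∈ supp g, ∀ y ∈ supp g, y ∈ cell ψ n z → y = z := by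
    choose N hN using exists_isolating_cell hψ (supp g)
    refine ⟨(supp g).sup N, fun z hz y hy h => hN z y hy (cell_anti (Finset.le_sup hz) z h)⟩
  refine ⟨x n, fun k => ?_⟩
  rcases le_total k n with h | h
  · exact hxn n k h
  · exact mass_eq_one (hx n) (mem_cell_self _ _) fun y hy hyk =>
      hn _ (hx n) y hy (cell_anti h _ hyk)

theorem eventually_isRoot_mem_cell [TopologicalSpace X] (hc : ∀ k, IsClopen {y | ψ y k})
    {g : FreeBooleanGroup X} {x : X} (hx : IsRoot ψ g x) (n : ℕ) :
    ∀ᶠ g' in 𝓝 g, ∀ y, IsRoot ψ g' y → y ∈ cell ψ n x := by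
  have : ∀ᶠ g' in 𝓝 g, ∀ k ∈ Finset.range (n + 1), mass (cell ψ k x) g' = mass (cell ψ k x) g :=
    (Filter.eventually_all_finset _).2 fun k _ => eventually_mass_eq (isClopen_cell hc k x) g
  filter_upwards [this] with g' hg' y hy
  refine mem_cell_of_mass_eq_one (fun k hk => ?_) fun k _ => hy k
  rw [hg' k (Finset.mem_range_succ_iff.2 hk), hx k]

/-- Partition the space into `T` and the parts of its complement that leave the cells of `x` at
level `n`. Near `g` all their parities are those of `g`. A root `y` outside `T` leaves at some `n`,
and by `hcut` its cell at level `n + 1` is exactly such a part; its parity for `g` is the difference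
of the parities of two consecutive cells of `x`, hence zero, although `y` is a root. -/
theorem eventually_isRoot_mem [TopologicalSpace X] (hψ : Function.Injective ψ)
    (hc : ∀ k, IsClopen {y | ψ y k}) {g : FreeBooleanGroup X} {x : X} (hx : IsRoot ψ g x)
    {T : Set X} (hT : IsClopen T) (hxT : x ∈ T)
    (hcut : ∀ y ∉ T, ∀ n, y ∈ cell ψ n x → y ∉ cell ψ (n + 1) x → Disjoint (cell ψ (n + 1) y) T) :
    ∀ᶠ g' in 𝓝 g, ∀ y, IsRoot ψ g' y → y ∈ T := by
  classical
  have hsep : ∀ y, y ∉ T → ∃ n, y ∈ cell ψ n x ∧ y ∉ cell ψ (n + 1) x := fun y hy =>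
    exists_separating_cell hψ fun H => hy (H ▸ hxT)
  let e : X → Option ℕ := fun y => if h : y ∈ T then none else some (hsep y h).choose
  have huniq : ∀ {y m n}, y ∈ cell ψ m x → y ∉ cell ψ (m + 1) x → y ∈ cell ψ n x →
      y ∉ cell ψ (n + 1) x → m = n := by
    intro y m n h1 h2 h3 h4
    rcases lt_trichotomy m n with h | h | h
    · exact absurd (cell_anti h x h3) h2
    · exact h
    · exact absurd (cell_anti h x h1) h4
  have hnone : e ⁻¹' {none} = T := by
    ext y; by_cases h : y ∈ T <;> simp [e, h]
  have hsome : ∀ n, e ⁻¹' {some n} = Tᶜ ∩ (cell ψ n x \ cell ψ (n + 1) x) := by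
    intro n
    ext y
    by_cases h : y ∈ T
    · simp [e, h]
    · have hs := (hsep y h).choose_spec
      have : e y = some (hsep y h).choose := dif_neg h
      rw [mem_preimage, this, mem_singleton_iff, Option.some_inj]
      constructor
      · rintro rfl
        exact ⟨h, hs⟩
      · rintro ⟨-, h1, h2⟩
        exact huniq hs.1 hs.2 h1 h2
  have he : ∀ a, IsOpen (e ⁻¹' {a}) := by
    rintro (_ | n)
    · rw [hnone]; exact hT.isOpen
    · rw [hsome]
      exact (hT.compl.inter ((isClopen_cell hc n x).diff (isClopen_cell hc (n + 1) x))).isOpen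
  filter_upwards [eventually_map_eq he g] with g' hg' y hy
  by_contra hyT
  obtain ⟨n, h1, h2⟩ := hsep y hyT
  have hdis := hcut y hyT n h1 h2
  have hfib : e ⁻¹' {some n} = cell ψ (n + 1) y := by
    rw [hsome, ← cell_succ_eq_diff h1 h2]
    exact inter_eq_right.2 hdis.subset_compl_right
  have hm : mass (cell ψ (n + 1) y) g' = mass (cell ψ (n + 1) y) g := by
    rw [← hfib, ← mass_map, ← mass_map, hg']
  have h3 := mass_inter_add_diff (cell ψ n x) (cell ψ (n + 1) x) g
  rw [inter_eq_right.2 (cell_anti n.le_succ x), ← cell_succ_eq_diff h1 h2, ← hm, hx, hx, hy] at h3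
  exact absurd h3 (by decide)

end FreeBooleanGroup

open FreeBooleanGroup

/-! ### Cuts of the line -/

/-- The sequence of cuts of a space over the line. -/
def cuts {X : Type} (v : X → ℝ) (q : ℕ → ℝ) (x : X) (k : ℕ) : Prop := v x < q k

/-- A continuous injection `v` into the line with a dense sequence `q` in the complement of its
range. -/
structure IsCut {X : Type} [TopologicalSpace X] (v : X → ℝ) (q : ℕ → ℝ) : Prop where
  continuous : Continuous v
  injective : Function.Injective v
  ne : ∀ x k, v x ≠ q k
  dense : ∀ a b : ℝ, a < b → ∃ k, a < q k ∧ q k < b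

namespace IsCut

variable {X : Type} [TopologicalSpace X] {v : X → ℝ} {q : ℕ → ℝ} (h : IsCut v q)
include h

theorem injective_cuts : Function.Injective (cuts v q) := by
  have key : ∀ x y, cuts v q x = cuts v q y → ¬ v x < v y := by
    intro x y hxy hlt
    obtain ⟨k, h1, h2⟩ := h.dense _ _ hlt
    have : cuts v q y k := hxy ▸ h1
    exact lt_asymm this h2
  intro x y hxy
  exact h.injective (le_antisymm (not_lt.1 (key y x hxy.symm)) (not_lt.1 (key x y hxy)))

theorem isClopen_cuts (k : ℕ) : IsClopen {x | cuts v q x k} := by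
  refine ⟨?_, isOpen_Iio.preimage h.continuous⟩
  have : {x | cuts v q x k} = v ⁻¹' Iic (q k) := by
    ext x
    exact (h.ne x k).le_iff_lt.symm
  rw [this]
  exact isClosed_Iic.preimage h.continuous

theorem exists_cell_subset (x : X) {V : Set ℝ} (hV : V ∈ 𝓝 (v x)) :
    ∃ n, ∀ y ∈ cell (cuts v q) n x, v y ∈ V := by
  obtain ⟨a, b, ⟨ha, hb⟩, hab⟩ := mem_nhds_iff_exists_Ioo_subset.1 hV
  obtain ⟨k, hk1, hk2⟩ := h.dense _ _ ha
  obtain ⟨l, hl1, hl2⟩ := h.dense _ _ hb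
  refine ⟨max k l + 1, fun y hy => hab ⟨?_, ?_⟩⟩
  · have : ¬ v y < q k := fun H =>
      lt_asymm hk2 ((hy k (Nat.lt_succ_of_le (le_max_left _ _))).1 H)
    exact hk1.trans_le (not_lt.1 this)
  · exact ((hy l (Nat.lt_succ_of_le (le_max_right _ _))).2 hl1 : v y < q l).trans hl2

theorem eventually_mem {g : FreeBooleanGroup X} {x : X} (hx : IsRoot (cuts v q) g x)
    {V : Set ℝ} (hV : V ∈ 𝓝 (v x)) : ∀ᶠ g' in 𝓝 g, ∀ y, IsRoot (cuts v q) g' y → v y ∈ V := by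
  obtain ⟨n, hn⟩ := h.exists_cell_subset x hV
  filter_upwards [eventually_isRoot_mem_cell h.isClopen_cuts hx n] with g' hg' y hy
  exact hn y (hg' y hy)

/-- Apply `eventually_isRoot_mem` to the left ray: a cut separating `x` from a point `y` on its
right leaves the whole next cell of `y` on the right of that cut. -/
theorem eventually_le {g : FreeBooleanGroup X} {x : X} (hx : IsRoot (cuts v q) g x)
    (ho : IsOpen {y | v y ≤ v x}) : ∀ᶠ g' in 𝓝 g, ∀ y, IsRoot (cuts v q) g' y → v y ≤ v x := by
  refine eventually_isRoot_mem (T := {y | v y ≤ v x}) h.injective_cuts h.isClopen_cuts hx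
    ⟨isClosed_Iic.preimage h.continuous, ho⟩ (le_refl (v x)) fun y hy n h1 h2 => ?_
  have hxy : v x < v y := not_le.1 hy
  have hn : ¬ (v y < q n ↔ v x < q n) := fun H => h2 (mem_cell_succ_iff.2 ⟨h1, H⟩)
  refine Set.disjoint_left.2 fun z hz (hzx : v z ≤ v x) => hn ?_
  have hzn : v z < q n ↔ v y < q n := (mem_cell_succ_iff.1 hz).2
  exact ⟨fun H => hxy.trans H, fun H => hzn.1 (hzx.trans_lt H)⟩

theorem eventually_ge {g : FreeBooleanGroup X} {x : X} (hx : IsRoot (cuts v q) g x)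
    (ho : IsOpen {y | v x ≤ v y}) : ∀ᶠ g' in 𝓝 g, ∀ y, IsRoot (cuts v q) g' y → v x ≤ v y := by
  refine eventually_isRoot_mem (T := {y | v x ≤ v y}) h.injective_cuts h.isClopen_cuts hx
    ⟨isClosed_Ici.preimage h.continuous, ho⟩ (le_refl (v x)) fun y hy n h1 h2 => ?_
  have hxy : v y < v x := not_le.1 hy
  have hn : ¬ (v y < q n ↔ v x < q n) := fun H => h2 (mem_cell_succ_iff.2 ⟨h1, H⟩)
  refine Set.disjoint_left.2 fun z hz (hzx : v x ≤ v z) => hn ?_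
  have hzn : v z < q n ↔ v y < q n := (mem_cell_succ_iff.1 hz).2
  exact ⟨fun H => hzx.trans_lt (hzn.2 H), fun H => hxy.trans H⟩

theorem isOpen_setOf_isRoot {x : X} (ho : IsOpen {x}) :
    IsOpen {g | IsRoot (cuts v q) g x} := by
  refine isOpen_iff_mem_nhds.2 fun g (hg : IsRoot _ g x) => ?_
  have hcl : IsClosed ({x} : Set X) := by
    rw [← h.injective.preimage_image {x}, image_singleton]
    exact isClosed_singleton.preimage h.continuous
  have hodd : ∀ᶠ g' in 𝓝 g, mass Set.univ g' = mass Set.univ g := eventually_mass_eq isClopen_univ g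
  have hmem := eventually_isRoot_mem (T := {x}) h.injective_cuts h.isClopen_cuts hg ⟨hcl, ho⟩ rfl
    fun y _ n _ h2 => by
      refine Set.disjoint_singleton_right.2 fun H => h2 ?_
      rw [cell_eq_of_mem H]
      exact mem_cell_self _ _
  filter_upwards [hodd, hmem] with g' h1 h2
  obtain ⟨y, hy⟩ := exists_isRoot h.injective_cuts (h1.trans hg.odd)
  have : y = x := h2 y hy
  exact this ▸ hy

theorem t1Space : T1Space (FreeBooleanGroup X) :=
  FreeBooleanGroup.t1Space h.injective_cuts h.isClopen_cuts

end IsCut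

/-! ### Products of two free Boolean groups over the line -/

section Product

variable {X Y : Type} [TopologicalSpace X] [TopologicalSpace Y] {v : X → ℝ} {w : Y → ℝ}
  {q r : ℕ → ℝ}

/-- Both components of `p` have roots, and these are in the relation `≤`. -/
def RootsLe (v : X → ℝ) (w : Y → ℝ) (q r : ℕ → ℝ) (p : FreeBooleanGroup X × FreeBooleanGroup Y) :
    Prop :=
  ∃ x y, IsRoot (cuts v q) p.1 x ∧ IsRoot (cuts w r) p.2 y ∧ v x ≤ w y

theorem eventually_not_odd {p : FreeBooleanGroup X × FreeBooleanGroup Y}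
    (hp : ¬ (mass Set.univ p.1 = 1 ∧ mass Set.univ p.2 = 1)) :
    ∀ᶠ p' in 𝓝 p, ¬ (mass Set.univ p'.1 = 1 ∧ mass Set.univ p'.2 = 1) := by
  filter_upwards [continuous_fst.continuousAt.eventually (eventually_mass_eq isClopen_univ p.1),
    continuous_snd.continuousAt.eventually (eventually_mass_eq isClopen_univ p.2)] with p' h1 h2
  rwa [h1, h2]

theorem eventually_roots (hv : IsCut v q) (hw : IsCut w r)
    {p : FreeBooleanGroup X × FreeBooleanGroup Y} {x : X} {y : Y}
    (hx : IsRoot (cuts v q) p.1 x) (hy : IsRoot (cuts w r) p.2 y)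
    {s : Set ℝ} (hs : ∀ᶠ g in 𝓝 p.1, ∀ x', IsRoot (cuts v q) g x' → v x' ∈ s)
    {t : Set ℝ} (ht : ∀ᶠ g in 𝓝 p.2, ∀ y', IsRoot (cuts w r) g y' → w y' ∈ t) :
    ∀ᶠ p' in 𝓝 p, ∃ x' y', IsRoot (cuts v q) p'.1 x' ∧ IsRoot (cuts w r) p'.2 y' ∧
      v x' ∈ s ∧ w y' ∈ t := by
  filter_upwards [continuous_fst.continuousAt.eventually (eventually_mass_eq isClopen_univ p.1),
    continuous_snd.continuousAt.eventually (eventually_mass_eq isClopen_univ p.2),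
    continuous_fst.continuousAt.eventually hs, continuous_snd.continuousAt.eventually ht]
    with p' h1 h2 h3 h4
  obtain ⟨x', hx'⟩ := exists_isRoot hv.injective_cuts (h1.trans hx.odd)
  obtain ⟨y', hy'⟩ := exists_isRoot hw.injective_cuts (h2.trans hy.odd)
  exact ⟨x', y', hx', hy', h3 x' hx', h4 y' hy'⟩

/-- Different roots stay apart in the Euclidean sense. Equal roots move only leftwards in the first
component and rightwards in the second, so `≤` persists. Elements without both roots are recognised
by the locally constant total parity. -/
theorem eventually_rootsLe_iff (hv : IsCut v q) (hw : IsCut w r)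
    (hX : ∀ x y, v x = w y → IsOpen {x' | v x' ≤ v x})
    (hY : ∀ x y, v x = w y → IsOpen {y' | w y ≤ w y'})
    (p : FreeBooleanGroup X × FreeBooleanGroup Y) :
    ∀ᶠ p' in 𝓝 p, RootsLe v w q r p' = RootsLe v w q r p := by
  have hneg : ∀ p : FreeBooleanGroup X × FreeBooleanGroup Y, ∀ x y,
      IsRoot (cuts v q) p.1 x → IsRoot (cuts w r) p.2 y → (RootsLe v w q r p ↔ v x ≤ w y) := by
    intro p x y hx hy
    refine ⟨fun ⟨x', y', hx', hy', h⟩ => ?_, fun h => ⟨x, y, hx, hy, h⟩⟩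
    rwa [hx.eq hv.injective_cuts hx', hy.eq hw.injective_cuts hy']
  by_cases hp : mass Set.univ p.1 = 1 ∧ mass Set.univ p.2 = 1
  · obtain ⟨x, hx⟩ := exists_isRoot hv.injective_cuts hp.1
    obtain ⟨y, hy⟩ := exists_isRoot hw.injective_cuts hp.2
    rcases lt_trichotomy (v x) (w y) with h | h | h
    · obtain ⟨m, h1, h2⟩ := exists_between h
      filter_upwards [eventually_roots hv hw hx hy (hv.eventually_mem hx (Iio_mem_nhds h1))
        (hw.eventually_mem hy (Ioi_mem_nhds h2))] with p' ⟨x', y', hx', hy', h3, h4⟩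
      rw [hneg p x y hx hy, hneg p' x' y' hx' hy']
      exact propext ⟨fun _ => h.le, fun _ => (lt_trans h3 h4).le⟩
    · filter_upwards [eventually_roots hv hw hx hy (s := Iic (v x)) (t := Ici (w y))
        (hv.eventually_le hx (hX x y h)) (hw.eventually_ge hy (hY x y h))]
        with p' ⟨x', y', hx', hy', h3, h4⟩
      rw [hneg p x y hx hy, hneg p' x' y' hx' hy']
      exact propext ⟨fun _ => h.le, fun _ => (le_trans h3 h.le).trans h4⟩
    · obtain ⟨m, h1, h2⟩ := exists_between h
      filter_upwards [eventually_roots hv hw hx hy (hv.eventually_mem hx (Ioi_mem_nhds h2))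
        (hw.eventually_mem hy (Iio_mem_nhds h1))] with p' ⟨x', y', hx', hy', h3, h4⟩
      rw [hneg p x y hx hy, hneg p' x' y' hx' hy']
      exact propext ⟨fun H => absurd (lt_trans h4 h3) (not_lt.2 H), fun H => absurd h (not_lt.2 H)⟩
  · have hno : ∀ p : FreeBooleanGroup X × FreeBooleanGroup Y,
        ¬ (mass Set.univ p.1 = 1 ∧ mass Set.univ p.2 = 1) → ¬ RootsLe v w q r p :=
      fun p hp ⟨x, y, hx, hy, _⟩ => hp ⟨hx.odd, hy.odd⟩
    filter_upwards [eventually_not_odd hp] with p' hp'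
    exact propext ⟨fun H => absurd H (hno _ hp'), fun H => absurd H (hno _ hp)⟩

/-- If the roots `x`, `y` of `p` have the same value `s`, nearby roots satisfy `v x' ≤ s ≤ w y'`,
and a common value must be `s`. If they differ, disjoint neighbourhoods exclude common values. -/
theorem eventually_common_root_eq (hv : IsCut v q) (hw : IsCut w r)
    (hX : ∀ x y, v x = w y → IsOpen {x' | v x' ≤ v x})
    (hY : ∀ x y, v x = w y → IsOpen {y' | w y ≤ w y'})
    (p : FreeBooleanGroup X × FreeBooleanGroup Y) :
    ∃ a : ℝ, ∀ᶠ p' in 𝓝 p, ∀ x y, IsRoot (cuts v q) p'.1 x → IsRoot (cuts w r) p'.2 y →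
      v x = w y → v x = a := by
  by_cases hp : mass Set.univ p.1 = 1 ∧ mass Set.univ p.2 = 1
  · obtain ⟨x, hx⟩ := exists_isRoot hv.injective_cuts hp.1
    obtain ⟨y, hy⟩ := exists_isRoot hw.injective_cuts hp.2
    refine ⟨v x, ?_⟩
    by_cases h : v x = w y
    · filter_upwards [continuous_fst.continuousAt.eventually (hv.eventually_le hx (hX x y h)),
        continuous_snd.continuousAt.eventually (hw.eventually_ge hy (hY x y h))]
        with p' h1 h2 x' y' hx' hy' h'
      have := h2 y' hy'
      rw [← h, ← h'] at this
      exact le_antisymm (h1 x' hx') this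
    · obtain ⟨s, hs, t, ht, hst⟩ := Filter.disjoint_iff.1 (disjoint_nhds_nhds.2 h)
      filter_upwards [continuous_fst.continuousAt.eventually (hv.eventually_mem hx hs),
        continuous_snd.continuousAt.eventually (hw.eventually_mem hy ht)]
        with p' h1 h2 x' y' hx' hy' h'
      exact absurd (h' ▸ h2 y' hy') (Set.disjoint_left.1 hst (h1 x' hx'))
  · refine ⟨0, ?_⟩
    filter_upwards [eventually_not_odd hp] with p' hp' x y hx hy
    exact absurd ⟨hx.odd, hy.odd⟩ hp'

theorem exists_continuous_indicator_le (hv : IsCut v q) (hw : IsCut w r)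
    (hX : ∀ x y, v x = w y → IsOpen {x' | v x' ≤ v x})
    (hY : ∀ x y, v x = w y → IsOpen {y' | w y ≤ w y'}) :
    ∃ f : FreeBooleanGroup X × FreeBooleanGroup Y → ℝ, Continuous f ∧
      (∀ x y, v x ≤ w y → f (of x, of y) = 1) ∧ ∀ x y, w y < v x → f (of x, of y) = 0 := by
  classical
  refine ⟨fun p => if RootsLe v w q r p then 1 else 0, ?_, fun x y h => ?_, fun x y h => ?_⟩
  · refine ((IsLocallyConstant.iff_eventually_eq _).2 fun p => ?_).continuous
    filter_upwards [eventually_rootsLe_iff hv hw hX hY p] with p' hp'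
    simp only [hp']
  · exact if_pos ⟨x, y, isRoot_of x, isRoot_of y, h⟩
  · refine if_neg ?_
    rintro ⟨x', y', hx', hy', h'⟩
    rw [← (isRoot_of x).eq hv.injective_cuts hx', ← (isRoot_of y).eq hw.injective_cuts hy'] at h'
    exact not_lt.2 h' h

theorem isClosed_and_isDiscrete_range_of (hv : IsCut v q) (hw : IsCut w r)
    (hX : ∀ x y, v x = w y → IsOpen {x' | v x' ≤ v x})
    (hY : ∀ x y, v x = w y → IsOpen {y' | w y ≤ w y'})
    {κ : Type} (a : κ → X) (b : κ → Y) (hab : ∀ c, v (a c) = w (b c)) :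
    let D : Set (FreeBooleanGroup X × FreeBooleanGroup Y) := range fun c => (of (a c), of (b c))
    IsClosed D ∧ IsDiscrete D := by
  have := hv.t1Space
  have := hw.t1Space
  intro D
  refine isClosed_and_discrete_iff.2 fun p => ?_
  obtain ⟨s, hs⟩ := eventually_common_root_eq hv hw hX hY p
  rw [Filter.disjoint_principal_right, mem_nhdsWithin_iff_eventually]
  have huniq : ∀ c c', v (a c) = v (a c') → a c = a c' ∧ b c = b c' := fun c c' h =>
    ⟨hv.injective h, hw.injective (by rw [← hab, ← hab, h])⟩
  -- At most one member of `D` has root value `s`; if it is not `p`, it is removed using T1.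
  have hne : ∀ᶠ p' in 𝓝 p, ∀ c, v (a c) = s → p' = (of (a c), of (b c)) → p' = p := by
    by_cases hex : ∃ c, v (a c) = s ∧ (of (a c), of (b c)) ≠ p
    · obtain ⟨c, hc, hcp⟩ := hex
      filter_upwards [isOpen_ne.mem_nhds hcp.symm] with p' hp' c' hc' h
      obtain ⟨h1, h2⟩ := huniq c' c (hc'.trans hc.symm)
      rw [h1, h2] at h
      exact absurd h hp'
    · push Not at hex
      exact Filter.Eventually.of_forall fun p' c hc h => h.trans (hex c hc)
  filter_upwards [hs, hne] with p' h1 h2 hp' hD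
  obtain ⟨c, rfl⟩ := hD
  exact hp' (h2 c (h1 _ _ (isRoot_of _) (isRoot_of _) (hab c)) rfl)

theorem exists_discreteFamily (hv : IsCut v q) (hw : IsCut w r)
    {κ : Type} (a : κ → X) (b : κ → Y) (hab : ∀ c, v (a c) = w (b c))
    (ha : Function.Injective a) (hX : ∀ x y, v x = w y → IsOpen {x})
    (hY : ∀ x y, v x = w y → IsOpen {y}) :
    ∃ F : Set (Set (FreeBooleanGroup X × FreeBooleanGroup Y)),
      (∀ V ∈ F, IsOpen V ∧ V.Nonempty) ∧ IsDiscreteFamily F ∧ #F = #κ := by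
  have hX' : ∀ x y, v x = w y → IsOpen {x' | v x' ≤ v x} := by
    intro x y h
    have : {x' | v x' ≤ v x} = v ⁻¹' Iio (v x) ∪ {x} := by
      ext x'
      exact le_iff_lt_or_eq.trans (or_congr Iff.rfl hv.injective.eq_iff)
    rw [this]
    exact (isOpen_Iio.preimage hv.continuous).union (hX x y h)
  have hY' : ∀ x y, v x = w y → IsOpen {y' | w y ≤ w y'} := by
    intro x y h
    have : {y' | w y ≤ w y'} = w ⁻¹' Ioi (w y) ∪ {y} := by
      ext y'
      change w y ≤ w y' ↔ w y < w y' ∨ y' = y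
      rw [le_iff_lt_or_eq, hw.injective.eq_iff, eq_comm]
    rw [this]
    exact (isOpen_Ioi.preimage hw.continuous).union (hY x y h)
  let O : κ → Set (FreeBooleanGroup X × FreeBooleanGroup Y) := fun c =>
    {p | IsRoot (cuts v q) p.1 (a c) ∧ IsRoot (cuts w r) p.2 (b c)}
  have hmem : ∀ c, (of (a c), of (b c)) ∈ O c := fun c => ⟨isRoot_of _, isRoot_of _⟩
  have hO : Function.Injective O := by
    intro c c' h
    have h1 := hmem c
    rw [h] at h1
    exact ha ((isRoot_of (a c)).eq hv.injective_cuts h1.1)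
  refine ⟨range O, ?_, fun p => ?_, mk_range_eq O hO⟩
  · rintro _ ⟨c, rfl⟩
    refine ⟨?_, _, hmem c⟩
    exact ((hv.isOpen_setOf_isRoot (hX _ _ (hab c))).preimage continuous_fst).inter
      ((hw.isOpen_setOf_isRoot (hY _ _ (hab c))).preimage continuous_snd)
  · obtain ⟨s, hs⟩ := eventually_common_root_eq hv hw hX' hY' p
    refine ⟨_, hs, ?_⟩
    have key : ∀ c, (O c ∩ {p' | ∀ x y, IsRoot (cuts v q) p'.1 x → IsRoot (cuts w r) p'.2 y →
        v x = w y → v x = s}).Nonempty → v (a c) = s := by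
      rintro c ⟨p', ⟨h1, h2⟩, h3⟩
      exact h3 _ _ h1 h2 (hab c)
    rintro _ ⟨⟨c, rfl⟩, hc⟩ _ ⟨⟨c', rfl⟩, hc'⟩
    rw [ha (hv.injective ((key c hc).trans (key c' hc').symm))]

end Product

/-! ### Factorizability -/

/-- Assign to `c` a network member around the image of `a c` and one around the image of `b c`,
inside the sets where the translated function is positive. Indices with the same pair satisfy `c ≤
c'` and `c' ≤ c`, so uncountably many indices would inject into countably many pairs. -/
theorem not_SGcnwFactorizable {G H : Type} [AddGroup G] [TopologicalSpace G] [AddGroup H]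
    [TopologicalSpace H] {κ : Type} [LinearOrder κ] [Uncountable κ] (a : κ → G) (b : κ → H)
    (f : G × H → ℝ) (hf : Continuous f) (h1 : ∀ c, f (a c, b c) = 1)
    (h0 : ∀ c c', c' < c → f (a c, b c') = 0) : ¬ SGcnwFactorizable (G × H) := by
  intro hfac
  obtain ⟨S, _, _, hS, ⟨N, hN, hnet⟩, g, k, -, hk, rfl⟩ := hfac f hf
  let α : κ → S := fun c => g (a c, 0)
  let β : κ → S := fun c => g (0, b c)
  have hαβ : ∀ c c', α c + β c' = g (a c, b c') := fun c c' => by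
    rw [← map_add, Prod.mk_add_mk, add_zero, zero_add]
  have hU : ∀ c, IsOpen {s | 0 < k (s + β c)} := fun c =>
    isOpen_Ioi.preimage (hk.comp SeparatelyContinuousAdd.continuous_add_const)
  have hV : ∀ c, IsOpen {s | 0 < k (α c + s)} := fun c =>
    isOpen_Ioi.preimage (hk.comp SeparatelyContinuousAdd.continuous_const_add)
  have hpos : ∀ c, 0 < k (α c + β c) := fun c => by
    rw [hαβ]
    exact one_pos.trans_eq (h1 c).symm
  have hle : ∀ c c', 0 < k (α c + β c') → c ≤ c' := by
    intro c c' h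
    by_contra! hlt
    rw [hαβ] at h
    exact h.ne' (h0 c c' hlt)
  choose P hPN hPα hPU using fun c => hnet _ (hU c) (α c) (hpos c)
  choose Q hQN hQβ hQV using fun c => hnet _ (hV c) (β c) (hpos c)
  have := hN.to_subtype
  have hinj : Function.Injective fun c => ((⟨P c, hPN c⟩, ⟨Q c, hQN c⟩) : N × N) := by
    intro c c' h
    have hP : P c = P c' := congrArg (fun z : N × N => z.1.1) h
    have hQ : Q c = Q c' := congrArg (fun z : N × N => z.2.1) h
    exact le_antisymm (hle _ _ (hPU c' (hP ▸ hPα c))) (hle _ _ (hQV c' (hQ ▸ hQβ c)))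
  exact not_countable hinj.countable

theorem SGcnwFactorizable.of_RFactorizable {G : Type} [AddGroup G] [TopologicalSpace G]
    (h : RFactorizable G) : SGcnwFactorizable G := by
  intro f hf
  obtain ⟨S, _, _, _, _, _, g, k, hg, hk, hfk⟩ := h f hf
  let _ := TopologicalSpace.metrizableSpaceMetric S
  have : SecondCountableTopology S := UniformSpace.secondCountable_of_separable S
  refine ⟨S, inferInstance, inferInstance, inferInstance,
    ⟨TopologicalSpace.countableBasis S, TopologicalSpace.countable_countableBasis S, ?_⟩,
    g, k, hg, hk, hfk⟩
  intro U hU x hx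
  exact (TopologicalSpace.isBasis_countableBasis S).exists_subset_of_mem_open hx hU

/-! ### Lindelöf free Boolean groups -/

theorem continuous_sum_range {W G : Type} [TopologicalSpace W] [TopologicalSpace G]
    [AddCommMonoid G] [ContinuousAdd G] {m : W → ℕ} (hm : Continuous m) {b : ℕ → W → G}
    (hb : ∀ i, Continuous (b i)) : Continuous fun y => ∑ i ∈ Finset.range (m y), b i y := by
  refine continuous_iff_continuousAt.2 fun y => ?_
  have h : ContinuousAt (fun y' => ∑ i ∈ Finset.range (m y), b i y') y :=
    (continuous_finsetSum _ fun i _ => hb i).continuousAt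
  refine h.congr ?_
  have hmy : ∀ᶠ y' in 𝓝 y, m y' ∈ ({m y} : Set ℕ) :=
    hm.continuousAt ((isOpen_discrete {m y}).mem_nhds rfl)
  filter_upwards [hmy] with y' hy'
  rw [mem_singleton_iff.1 hy']

/-- Spread a point of the countable power of `Y` over pairs: coordinate `(n, 0)`, taken in `N`,
encodes the number of summands of the `n`-th group element, and coordinates `(n, i + 1)`, taken in
`F`, encode the summands. The admissible points form a closed set mapping onto the power of the
group. -/
theorem lindelof_freeBooleanGroup {X Y : Type} [TopologicalSpace X] [TopologicalSpace Y]
    [Nonempty X] (hY : LindelofToCountableDegree Y) {F : Set Y} (hF : IsClosed F) {p : F → X}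
    (hp : Continuous p) (hps : Function.Surjective p) {N : Set Y} (hN : IsClosed N) {m : N → ℕ}
    (hm : Continuous m) (hms : Function.Surjective m) :
    LindelofToCountableDegree (FreeBooleanGroup X) := by
  have : LindelofSpace (ℕ → Y) := hY
  let W : Set (ℕ → Y) := {y | ∀ n, y (Nat.pair n 0) ∈ N ∧ ∀ i, y (Nat.pair n (i + 1)) ∈ F}
  have hW : IsClosed W := by
    have : W = ⋂ n, ((fun y : ℕ → Y => y (Nat.pair n 0)) ⁻¹' N ∩
        ⋂ i, (fun y : ℕ → Y => y (Nat.pair n (i + 1))) ⁻¹' F) := by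
      ext y
      simp [W]
    rw [this]
    exact isClosed_iInter fun n => (hN.preimage (continuous_apply _)).inter
      (isClosed_iInter fun i => hF.preimage (continuous_apply _))
  have : LindelofSpace W := isLindelof_iff_lindelofSpace.1 hW.isLindelof
  let Θ : W → ℕ → FreeBooleanGroup X := fun y n =>
    ∑ i ∈ Finset.range (m ⟨y.1 (Nat.pair n 0), (y.2 n).1⟩),
      of (p ⟨y.1 (Nat.pair n (i + 1)), (y.2 n).2 i⟩)
  have hval : ∀ n, Continuous fun y : W => y.1 n := fun n =>
    (continuous_apply n).comp continuous_subtype_val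
  have hΘ : Continuous Θ := continuous_pi fun n =>
    continuous_sum_range (hm.comp ((hval _).subtype_mk fun y => (y.2 n).1)) fun i =>
      continuous_of.comp (hp.comp ((hval _).subtype_mk fun y => (y.2 n).2 i))
  refine LindelofSpace.of_continuous_surjective hΘ fun g => ?_
  choose l x hx using fun n => exists_sum_eq (g n)
  choose p' hp' using hps
  choose m' hm' using hms
  let z : ℕ → ℕ → Y := fun n i => Nat.casesOn i (m' (l n)).1 fun i => (p' (x n i)).1
  have hz : (fun k => z k.unpair.1 k.unpair.2) ∈ W := by
    intro n
    simp only [Nat.unpair_pair]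
    exact ⟨(m' (l n)).2, fun i => (p' (x n i)).2⟩
  refine ⟨⟨_, hz⟩, funext fun n => ?_⟩
  rw [← hx n]
  have h0 : m ⟨z (Nat.pair n 0).unpair.1 (Nat.pair n 0).unpair.2, (hz n).1⟩ = l n := by
    rw [← hm' (l n)]
    congr 1
    exact Subtype.ext (by simp only [Nat.unpair_pair]; rfl)
  change ∑ i ∈ Finset.range (m ⟨z (Nat.pair n 0).unpair.1 (Nat.pair n 0).unpair.2, (hz n).1⟩), _ = _
  rw [h0]
  refine Finset.sum_congr rfl fun i _ => ?_
  refine congrArg of ?_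
  rw [← hp' (x n i)]
  congr 1
  refine Subtype.ext ?_
  simp only [Nat.unpair_pair]
  rfl

theorem SpI.continuous_rng {W : Type} [TopologicalSpace W] {X A : Set ℝ} {f : W → SpI X A}
    (hf : Continuous fun y => (f y).val)
    (hx : ∀ x : SpI X A, x.val ∉ A → IsOpen (f ⁻¹' {x})) : Continuous f := by
  refine continuous_generateFrom_iff.2 ?_
  rintro _ (hU | ⟨x, hxA, rfl⟩)
  · obtain ⟨V, hV, rfl⟩ := isOpen_induced_iff.1 hU
    exact hV.preimage hf
  · exact hx x hxA

theorem SpI.injective_val {X A : Set ℝ} : Function.Injective (SpI.val (X := X) (A := A)) :=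
  Subtype.val_injective

/-- `X` is closed in the modified line because all points outside it are isolated; the closed set of
naturals supplies the lengths. -/
theorem lindelof_freeBooleanGroup_of_SpI {X A : Set ℝ}
    (hA : LindelofToCountableDegree (SpI univ A)) (hAX : A ⊆ X) {T : Type} [TopologicalSpace T]
    [Nonempty T] {p : SpI X A → T} (hp : Continuous p) (hps : Function.Surjective p) :
    LindelofToCountableDegree (FreeBooleanGroup T) := by
  let F : Set (SpI univ A) := SpI.val ⁻¹' X
  have hF : IsClosed F := by
    have : Fᶜ = ⋃ x ∈ Fᶜ, {x} := (biUnion_of_singleton _).symm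
    rw [← isOpen_compl_iff, this]
    exact isOpen_biUnion fun x hx => SpI.isOpen_singleton fun H => hx (hAX H)
  let p' : F → SpI X A := fun x => (⟨x.1.val, x.2⟩ : X)
  have hp' : Continuous p' := by
    refine SpI.continuous_rng 
      (show Continuous fun y : F => y.1.val from
        SpI.continuous_val.comp continuous_subtype_val) fun x hx => ?_
    let x' : SpI univ A := (⟨x.val, trivial⟩ : (univ : Set ℝ))
    have : p' ⁻¹' {x} = Subtype.val ⁻¹' {x'} := by
      ext y
      change p' y = x ↔ y.1 = x'
      rw [← SpI.injective_val.eq_iff, ← SpI.injective_val.eq_iff]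
      rfl
    rw [this]
    exact IsOpen.preimage continuous_subtype_val
      (SpI.isOpen_singleton (x := (⟨x.val, trivial⟩ : (univ : Set ℝ))) hx)
  have hps' : Function.Surjective p' := fun x =>
    ⟨⟨(⟨x.val, trivial⟩ : (univ : Set ℝ)), x.2⟩, rfl⟩
  let N : Set (SpI univ A) := SpI.val ⁻¹' range ((↑) : ℕ → ℝ)
  have hN : IsClosed N :=
    Nat.isClosedEmbedding_coe_real.isClosed_range.preimage SpI.continuous_val
  choose m hm using fun x : N => x.2
  have hmc : Continuous m := by
    rw [Nat.isClosedEmbedding_coe_real.isInducing.continuous_iff]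
    exact (SpI.continuous_val.comp continuous_subtype_val).congr fun x => (hm x).symm
  have hms : Function.Surjective m := fun k => by
    refine ⟨⟨(⟨k, trivial⟩ : (univ : Set ℝ)), ⟨k, rfl⟩⟩, ?_⟩
    exact Nat.cast_injective (R := ℝ) (hm _)
  exact lindelof_freeBooleanGroup hA hF (hp.comp hp') (hps.comp hps') hN hmc hms

/-! ### The one-sided topologies -/

/-- The inclusion into the line. -/
def SpL.val {X A : Set ℝ} (x : SpL X A) : ℝ := Subtype.val (p := (· ∈ X)) x

/-- The inclusion into the line. -/
def SpR.val {X A : Set ℝ} (x : SpR X A) : ℝ := Subtype.val (p := (· ∈ X)) x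

/-- The identity map. -/
def SpI.toL {X A : Set ℝ} (x : SpI X A) : SpL X A := x

/-- The identity map. -/
def SpI.toR {X A : Set ℝ} (x : SpI X A) : SpR X A := x

section

variable {X A : Set ℝ}

theorem SpL.continuous_val : Continuous (SpL.val (X := X) (A := A)) :=
  ⟨fun _ hU => TopologicalSpace.isOpen_generateFrom_of_mem
    (Or.inl (hU.preimage (continuous_subtype_val (p := (· ∈ X)))))⟩

theorem SpR.continuous_val : Continuous (SpR.val (X := X) (A := A)) :=
  ⟨fun _ hU => TopologicalSpace.isOpen_generateFrom_of_mem
    (Or.inl (hU.preimage (continuous_subtype_val (p := (· ∈ X)))))⟩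

theorem SpL.isOpen_le {x : SpL X A} (hx : x.val ∉ A) : IsOpen {y : SpL X A | y.val ≤ x.val} :=
  TopologicalSpace.isOpen_generateFrom_of_mem (Or.inr ⟨x, hx, rfl⟩)

theorem SpR.isOpen_ge {x : SpR X A} (hx : x.val ∉ A) : IsOpen {y : SpR X A | x.val ≤ y.val} :=
  TopologicalSpace.isOpen_generateFrom_of_mem (Or.inr ⟨x, hx, rfl⟩)

theorem SpI.continuous_toL : Continuous (SpI.toL (X := X) (A := A)) := by
  refine continuous_generateFrom_iff.2 ?_
  rintro _ (hU | ⟨x, hxA, rfl⟩)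
  · exact SpI.isOpen_of_isOpen hU
  · have : {y : SpI X A | y.val ≤ (x : ℝ)} = SpI.val ⁻¹' Iio (x : ℝ) ∪ {(x : SpI X A)} := by
      ext y
      refine (le_iff_lt_or_eq (a := y.val) (b := (x : ℝ))).trans (or_congr Iff.rfl ?_)
      exact ⟨fun h => SpI.injective_val h, fun h => congrArg SpI.val h⟩
    change IsOpen {y : SpI X A | y.val ≤ (x : ℝ)}
    rw [this]
    exact (isOpen_Iio.preimage SpI.continuous_val).union (SpI.isOpen_singleton hxA)

theorem SpI.continuous_toR : Continuous (SpI.toR (X := X) (A := A)) := by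
  refine continuous_generateFrom_iff.2 ?_
  rintro _ (hU | ⟨x, hxA, rfl⟩)
  · exact SpI.isOpen_of_isOpen hU
  · have : {y : SpI X A | (x : ℝ) ≤ y.val} = SpI.val ⁻¹' Ioi (x : ℝ) ∪ {(x : SpI X A)} := by
      ext y
      refine (le_iff_lt_or_eq (a := (x : ℝ)) (b := y.val)).trans (or_congr Iff.rfl ?_)
      exact ⟨fun h => SpI.injective_val h.symm, fun h => (congrArg SpI.val h).symm⟩
    change IsOpen {y : SpI X A | (x : ℝ) ≤ y.val}
    rw [this]
    exact (isOpen_Ioi.preimage SpI.continuous_val).union (SpI.isOpen_singleton hxA)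

/-- Serves for separability: open sets still contain left intervals, so Euclidean dense sequences
stay dense. -/
theorem SpL.exists_Ioc_subset {U : Set (SpL X A)} (hU : IsOpen U) :
    ∀ x ∈ U, ∃ u < x.val, ∀ y : SpL X A, u < y.val → y.val ≤ x.val → y ∈ U := by
  induction hU with
  | basic s hs =>
    intro x hx
    rcases hs with hs | ⟨z, -, rfl⟩
    · obtain ⟨V, hV, rfl⟩ := isOpen_induced_iff.1 hs
      obtain ⟨a, b, ⟨ha, hb⟩, hab⟩ := mem_nhds_iff_exists_Ioo_subset.1 (hV.mem_nhds hx)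
      exact ⟨a, ha, fun y h1 h2 => hab ⟨h1, lt_of_le_of_lt h2 hb⟩⟩
    · exact ⟨x.val - 1, sub_one_lt _, fun y _ h2 => le_trans (α := X) h2 hx⟩
  | univ => exact fun x _ => ⟨x.val - 1, sub_one_lt _, fun _ _ _ => trivial⟩
  | inter s t _ _ h1 h2 =>
    intro x hx
    obtain ⟨u, hu, h⟩ := h1 x hx.1
    obtain ⟨u', hu', h'⟩ := h2 x hx.2
    exact ⟨max u u', max_lt hu hu', fun y hy hyx =>
      ⟨h y (lt_of_le_of_lt (le_max_left _ _) hy) hyx,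
        h' y (lt_of_le_of_lt (le_max_right _ _) hy) hyx⟩⟩
  | sUnion S _ ih =>
    rintro x ⟨s, hs, hxs⟩
    obtain ⟨u, hu, h⟩ := ih s hs x hxs
    exact ⟨u, hu, fun y hy hyx => ⟨s, hs, h y hy hyx⟩⟩

theorem SpR.exists_Ico_subset {U : Set (SpR X A)} (hU : IsOpen U) :
    ∀ x ∈ U, ∃ u > x.val, ∀ y : SpR X A, y.val < u → x.val ≤ y.val → y ∈ U := by
  induction hU with
  | basic s hs =>
    intro x hx
    rcases hs with hs | ⟨z, -, rfl⟩
    · obtain ⟨V, hV, rfl⟩ := isOpen_induced_iff.1 hs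
      obtain ⟨a, b, ⟨ha, hb⟩, hab⟩ := mem_nhds_iff_exists_Ioo_subset.1 (hV.mem_nhds hx)
      exact ⟨b, hb, fun y h1 h2 => hab ⟨lt_of_lt_of_le ha h2, h1⟩⟩
    · exact ⟨x.val + 1, lt_add_one _, fun y _ h2 => le_trans (α := X) hx h2⟩
  | univ => exact fun x _ => ⟨x.val + 1, lt_add_one _, fun _ _ _ => trivial⟩
  | inter s t _ _ h1 h2 =>
    intro x hx
    obtain ⟨u, hu, h⟩ := h1 x hx.1
    obtain ⟨u', hu', h'⟩ := h2 x hx.2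
    exact ⟨min u u', lt_min hu hu', fun y hy hyx =>
      ⟨h y (lt_of_lt_of_le hy (min_le_left _ _)) hyx,
        h' y (lt_of_lt_of_le hy (min_le_right _ _)) hyx⟩⟩
  | sUnion S _ ih =>
    rintro x ⟨s, hs, hxs⟩
    obtain ⟨u, hu, h⟩ := ih s hs x hxs
    exact ⟨u, hu, fun y hy hyx => ⟨s, hs, h y hy hyx⟩⟩

theorem SpL.separableSpace {q : ℕ → ℝ} (hq : ∀ k, q k ∈ X)
    (hd : ∀ a b : ℝ, a < b → ∃ k, a < q k ∧ q k < b) :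
    TopologicalSpace.SeparableSpace (SpL X A) := by
  let q' : ℕ → SpL X A := fun k => (⟨q k, hq k⟩ : X)
  refine ⟨range q', countable_range _, dense_iff_inter_open.2 ?_⟩
  rintro U hU ⟨x, hx⟩
  obtain ⟨u, hu, h⟩ := SpL.exists_Ioc_subset hU x hx
  obtain ⟨k, h1, h2⟩ := hd _ _ hu
  exact ⟨q' k, h _ h1 h2.le, k, rfl⟩

theorem SpR.separableSpace {q : ℕ → ℝ} (hq : ∀ k, q k ∈ X)
    (hd : ∀ a b : ℝ, a < b → ∃ k, a < q k ∧ q k < b) :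
    TopologicalSpace.SeparableSpace (SpR X A) := by
  let q' : ℕ → SpR X A := fun k => (⟨q k, hq k⟩ : X)
  refine ⟨range q', countable_range _, dense_iff_inter_open.2 ?_⟩
  rintro U hU ⟨x, hx⟩
  obtain ⟨u, hu, h⟩ := SpR.exists_Ico_subset hU x hx
  obtain ⟨k, h1, h2⟩ := hd _ _ hu
  exact ⟨q' k, h _ h2 h1.le, k, rfl⟩

theorem exists_dense_seq {B : Set ℝ} (hB : ∀ a b : ℝ, a < b → ∃ x ∈ B, a < x ∧ x < b) :
    ∃ q : ℕ → ℝ, (∀ k, q k ∈ B) ∧ ∀ a b : ℝ, a < b → ∃ k, a < q k ∧ q k < b := by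
  have : Nonempty {p : ℚ × ℚ // p.1 < p.2} := ⟨⟨(0, 1), zero_lt_one⟩⟩
  obtain ⟨e, he⟩ := exists_surjective_nat {p : ℚ × ℚ // p.1 < p.2}
  choose q hqB hq using fun k => hB (e k).1.1 (e k).1.2 (Rat.cast_lt.2 (e k).2)
  refine ⟨q, hqB, fun a b hab => ?_⟩
  obtain ⟨s, has, hsb⟩ := exists_rat_btwn hab
  obtain ⟨t, hst, htb⟩ := exists_rat_btwn hsb
  obtain ⟨k, hk⟩ := he ⟨(s, t), Rat.cast_lt.1 hst⟩
  have h := hq k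
  rw [hk] at h
  exact ⟨k, has.trans h.1, h.2.trans htb⟩

variable {q : ℕ → ℝ}

theorem SpI.isCut (hq : ∀ k, q k ∉ X) (hd : ∀ a b : ℝ, a < b → ∃ k, a < q k ∧ q k < b) :
    IsCut (SpI.val (X := X) (A := A)) q :=
  ⟨SpI.continuous_val, SpI.injective_val, fun x k h => hq k (h ▸ x.2), hd⟩

theorem SpL.isCut (hq : ∀ k, q k ∉ X) (hd : ∀ a b : ℝ, a < b → ∃ k, a < q k ∧ q k < b) :
    IsCut (SpL.val (X := X) (A := A)) q :=
  ⟨SpL.continuous_val, Subtype.val_injective, fun x k h => hq k (h ▸ x.2), hd⟩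

theorem SpR.isCut (hq : ∀ k, q k ∉ X) (hd : ∀ a b : ℝ, a < b → ∃ k, a < q k ∧ q k < b) :
    IsCut (SpR.val (X := X) (A := A)) q :=
  ⟨SpR.continuous_val, Subtype.val_injective, fun x k h => hq k (h ▸ x.2), hd⟩

end

/-! ### Cardinalities -/

theorem mk_freeBooleanGroup_le {X : Type} [Nonempty X] (hX : #X ≤ 𝔠) :
    #(FreeBooleanGroup X) ≤ 𝔠 := by
  have hs : Function.Surjective fun z : ℕ × (ℕ → X) => ∑ i ∈ Finset.range z.1, of (z.2 i) :=
    fun g => by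
      obtain ⟨m, x, h⟩ := exists_sum_eq g
      exact ⟨(m, x), h⟩
  refine (Cardinal.mk_le_of_surjective hs).trans ?_
  have h1 : #(ℕ → X) ≤ 𝔠 := by
    rw [← Cardinal.power_def, Cardinal.mk_nat]
    exact (Cardinal.power_le_power_right hX).trans Cardinal.continuum_power_aleph0.le
  rw [Cardinal.mk_prod, Cardinal.lift_id, Cardinal.lift_id, Cardinal.mk_nat]
  exact (mul_le_mul' Cardinal.aleph0_le_continuum h1).trans Cardinal.continuum_mul_self.le

/-- Members of a discrete family are disjoint, so a choice of points bounds their number by the size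
of the space. -/
theorem discreteSuslinNumber_eq {Z : Type} [TopologicalSpace Z] {c : Cardinal} (hZ : #Z ≤ c)
    {F : Set (Set Z)} (hF : ∀ V ∈ F, IsOpen V ∧ V.Nonempty) (hd : IsDiscreteFamily F)
    (hc : c ≤ #F) : discreteSuslinNumber Z = c := by
  refine le_antisymm (ciSup_le' fun E => ?_)
    (hc.trans (le_ciSup (f := fun E : {F : Set (Set Z) // (∀ V ∈ F, IsOpen V ∧ V.Nonempty) ∧
      IsDiscreteFamily F} => #(E.1)) Cardinal.bddAbove_of_small ⟨F, hF, hd⟩))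
  obtain ⟨E, hE, hEd⟩ := E
  choose x hx using fun V : E => (hE V V.2).2
  refine (Cardinal.mk_le_of_injective (f := x) fun V V' h => ?_).trans hZ
  obtain ⟨U, hU, hs⟩ := hEd (x V)
  refine Subtype.ext (hs ⟨V.2, x V, hx V, mem_of_mem_nhds hU⟩ ⟨V'.2, x V, ?_, mem_of_mem_nhds hU⟩)
  exact h ▸ hx V'

theorem extent_eq {Z : Type} [TopologicalSpace Z] {c : Cardinal} (hZ : #Z ≤ c)
    {D : Set Z} (hD : IsClosed D ∧ IsDiscrete D) (hc : c ≤ #D) : extent Z = c :=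
  le_antisymm (ciSup_le' fun E => (Cardinal.mk_set_le E.1).trans hZ)
    (hc.trans (le_ciSup (f := fun E : {D : Set Z // IsClosed D ∧ IsDiscrete D} => #(E.1))
      Cardinal.bddAbove_of_small ⟨D, hD⟩))

theorem IsOkunevTamanoPartition.continuum_le_mk_setC {ι : Type} {M : ι → Set ℝ}
    (hM : IsOkunevTamanoPartition M) (i j : ι) : 𝔠 ≤ #(setC (M i) (M j)) := by
  have : Infinite ι := Cardinal.infinite_iff.2 (hM.card_index ▸ Cardinal.aleph0_le_continuum)
  have hfin : #({i, j} : Set ι) < #ι :=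
    (Cardinal.lt_aleph0_iff_set_finite.2 (toFinite _)).trans_le (Cardinal.aleph0_le_mk ι)
  choose x hx using hM.nonempty
  have hne : ∀ k l, x k ∈ M l → k = l := by
    intro k l h
    by_contra hkl
    exact Set.disjoint_left.1 (hM.disjoint k l hkl) (hx k) h
  have key : #(({i, j} : Set ι)ᶜ : Set ι) = 𝔠 :=
    (Cardinal.mk_compl_of_infinite _ hfin).trans hM.card_index
  rw [← key]
  refine Cardinal.mk_le_of_injective (f := fun k => ⟨x k.1, fun H => k.2 ?_⟩) fun k l h => ?_
  · rcases H with H | H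
    · exact Or.inl (hne _ _ H)
    · exact Or.inr (hne _ _ H)
  · have h' : x k.1 = x l.1 := congrArg Subtype.val h
    exact Subtype.ext (hne _ _ (h' ▸ hx l.1))

end BoolProd

/-! ### Assembly of the theorem. -/

open BoolProd FreeBooleanGroup in
theorem theoremt :
    (∃ (ι : Type) (M : ι → Set ℝ), BoolProd.IsOkunevTamanoPartition M) ∧
    ∀ (ι : Type) (M : ι → Set ℝ), BoolProd.IsOkunevTamanoPartition M →
      ∀ (i j : ι), i ≠ j → ∀ (A B : Set ℝ), A = M i → B = M j →
        -- all four groups are Lindelöf to countable degree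
        (BoolProd.LindelofToCountableDegree (BoolProd.G1 A B) ∧
          BoolProd.LindelofToCountableDegree (BoolProd.H1 A B) ∧
          BoolProd.LindelofToCountableDegree (BoolProd.G2 A B) ∧
          BoolProd.LindelofToCountableDegree (BoolProd.H2 A B)) ∧
        -- the first product
        (¬ BoolProd.SGcnwFactorizable (BoolProd.G1 A B × BoolProd.H1 A B) ∧
          ¬ BoolProd.RFactorizable (BoolProd.G1 A B × BoolProd.H1 A B) ∧
          BoolProd.discreteSuslinNumber (BoolProd.G1 A B × BoolProd.H1 A B) =
            Cardinal.continuum) ∧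
        -- the second product
        (¬ BoolProd.SGcnwFactorizable (BoolProd.G2 A B × BoolProd.H2 A B) ∧
          ¬ BoolProd.RFactorizable (BoolProd.G2 A B × BoolProd.H2 A B) ∧
          ¬ NormalSpace (BoolProd.G2 A B × BoolProd.H2 A B) ∧
          TopologicalSpace.SeparableSpace (BoolProd.G2 A B × BoolProd.H2 A B) ∧
          BoolProd.extent (BoolProd.G2 A B × BoolProd.H2 A B) = Cardinal.continuum) := by
  refine ⟨BoolProd.exists_okunevTamanoPartition, ?_⟩
  rintro ι M hM i j hij A B rfl rfl

  have hdisj : Disjoint (M i) (M j) := hM.disjoint i j hij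
  have hLB : ∀ x ∈ setL (M i) (M j), x ∉ M j := by
    rintro x (h | h) hx
    exacts [Set.disjoint_left.1 hdisj h hx, h (Or.inr hx)]
  have hRA : ∀ x ∈ setR (M i) (M j), x ∉ M i := by
    rintro x (h | h) hx
    exacts [Set.disjoint_left.1 hdisj hx h, h (Or.inl hx)]
  -- Each sequence plays two roles: `q`, inside `B`, cuts `L` and is dense in `R`; `r`, inside `A`,
  -- cuts `R` and is dense in `L`.
  obtain ⟨q, hqB, hq⟩ := exists_dense_seq fun a b => exists_mem_Ioo_of_lindelof (hM.lindelof j)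
  obtain ⟨r, hrA, hr⟩ := exists_dense_seq fun a b => exists_mem_Ioo_of_lindelof (hM.lindelof i)
  have hqL : ∀ k, q k ∉ setL (M i) (M j) := fun k h => hLB _ h (hqB k)
  have hrR : ∀ k, r k ∉ setR (M i) (M j) := fun k h => hRA _ h (hrA k)
  have cI₁ := SpI.isCut (A := M i) hqL hq
  have cI₂ := SpI.isCut (A := M j) hrR hr
  have cL := SpL.isCut (A := M i) hqL hq
  have cR := SpR.isCut (A := M j) hrR hr
  have hX : ∀ (x : SpL (setL (M i) (M j)) (M i)) (y : SpR (setR (M i) (M j)) (M j)),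
      x.val = y.val → IsOpen {x' : SpL (setL (M i) (M j)) (M i) | x'.val ≤ x.val} :=
    fun x y h => SpL.isOpen_le (h ▸ hRA _ y.2)
  have hY : ∀ (x : SpL (setL (M i) (M j)) (M i)) (y : SpR (setR (M i) (M j)) (M j)),
      x.val = y.val → IsOpen {y' : SpR (setR (M i) (M j)) (M j) | y.val ≤ y'.val} :=
    fun x y h => SpR.isOpen_ge (h ▸ hLB _ x.2)
  have hC := hM.continuum_le_mk_setC i j
  have : Uncountable (setC (M i) (M j)) :=
    Cardinal.aleph0_lt_mk_iff.1 (Cardinal.aleph0_lt_continuum.trans_le hC)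
  obtain ⟨c₀⟩ : Nonempty (setC (M i) (M j)) := inferInstance
  let a₁ : setC (M i) (M j) → SpI (setL (M i) (M j)) (M i) := fun c => (⟨c, Or.inr c.2⟩ : setL _ _)
  let b₁ : setC (M i) (M j) → SpI (setR (M i) (M j)) (M j) := fun c => (⟨c, Or.inr c.2⟩ : setR _ _)
  have : Nonempty (SpI (setL (M i) (M j)) (M i)) := ⟨a₁ c₀⟩
  have : Nonempty (SpI (setR (M i) (M j)) (M j)) := ⟨b₁ c₀⟩
  have : Nonempty (SpL (setL (M i) (M j)) (M i)) := ⟨(a₁ c₀).toL⟩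
  have : Nonempty (SpR (setR (M i) (M j)) (M j)) := ⟨(b₁ c₀).toR⟩
  have ha₁ : Function.Injective a₁ := fun c c' h =>
    Subtype.ext (show (a₁ c).val = (a₁ c').val from congrArg SpI.val h)
  have mk_le : ∀ {G H : Type}, #G ≤ 𝔠 → #H ≤ 𝔠 → #(G × H) ≤ 𝔠 := fun {G H} hG hH => by
    rw [Cardinal.mk_prod, Cardinal.lift_id, Cardinal.lift_id]
    exact (mul_le_mul' hG hH).trans Cardinal.continuum_mul_self.le
  have mk_set : ∀ X : Set ℝ, #X ≤ 𝔠 := fun X => (Cardinal.mk_set_le X).trans Cardinal.mk_real.le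
  have hG₁ : #(G1 (M i) (M j) × H1 (M i) (M j)) ≤ 𝔠 :=
    mk_le (mk_freeBooleanGroup_le (mk_set _)) (mk_freeBooleanGroup_le (mk_set _))
  have hG₂ : #(G2 (M i) (M j) × H2 (M i) (M j)) ≤ 𝔠 :=
    mk_le (mk_freeBooleanGroup_le (mk_set _)) (mk_freeBooleanGroup_le (mk_set _))
  obtain ⟨f, hf, hf1, hf0⟩ := exists_continuous_indicator_le cL cR hX hY
  have hSG₂ : ¬ SGcnwFactorizable (G2 (M i) (M j) × H2 (M i) (M j)) :=
    not_SGcnwFactorizable (fun c => of (a₁ c).toL) (fun c => of (b₁ c).toR) f hf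
      (fun c => hf1 _ _ le_rfl) fun c c' h => hf0 _ _ h
  -- The one-sided topologies are coarser, so the indicator pulls back along the identity of the
  -- bases.
  have hSG₁ : ¬ SGcnwFactorizable (G1 (M i) (M j) × H1 (M i) (M j)) := by
    refine not_SGcnwFactorizable (fun c => of (a₁ c)) (fun c => of (b₁ c))
      (fun p => f (map SpI.toL p.1, map SpI.toR p.2)) ?_ (fun c => ?_) fun c c' h => ?_
    · exact hf.comp (((continuous_map SpI.continuous_toL).comp continuous_fst).prodMk
        ((continuous_map SpI.continuous_toR).comp continuous_snd))
    · rw [map_of, map_of]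
      exact hf1 _ _ le_rfl
    · rw [map_of, map_of]
      exact hf0 _ _ h
  have hD := isClosed_and_isDiscrete_range_of cL cR hX hY (fun c => (a₁ c).toL)
    (fun c => (b₁ c).toR) fun c => rfl
  have hDc : 𝔠 ≤ #(range fun c => ((of (a₁ c).toL, of (b₁ c).toR) :
      G2 (M i) (M j) × H2 (M i) (M j))) := by
    rwa [Cardinal.mk_range_eq]
    intro c c' h
    refine ha₁ (IsRoot.eq (g := of (a₁ c).toL) cL.injective_cuts (isRoot_of _) ?_)
    rw [show of (a₁ c).toL = of (a₁ c').toL from congrArg Prod.fst h]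
    exact isRoot_of _
  have : TopologicalSpace.SeparableSpace (SpL (setL (M i) (M j)) (M i)) :=
    SpL.separableSpace (fun k => Or.inl (hrA k)) hr
  have : TopologicalSpace.SeparableSpace (SpR (setR (M i) (M j)) (M j)) :=
    SpR.separableSpace (fun k => Or.inl (hqB k)) hq
  have : TopologicalSpace.SeparableSpace (G2 (M i) (M j)) := separableSpace
  have : TopologicalSpace.SeparableSpace (H2 (M i) (M j)) := separableSpace
  refine ⟨⟨?_, ?_, ?_, ?_⟩, ⟨hSG₁, fun h => hSG₁ (.of_RFactorizable h), ?_⟩,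
    hSG₂, fun h => hSG₂ (.of_RFactorizable h), ?_, inferInstance, extent_eq hG₂ hD hDc⟩
  · exact lindelof_freeBooleanGroup_of_SpI (hM.lindelof i) subset_union_left continuous_id
      Function.surjective_id
  · exact lindelof_freeBooleanGroup_of_SpI (hM.lindelof j) subset_union_left continuous_id
      Function.surjective_id
  · exact lindelof_freeBooleanGroup_of_SpI (hM.lindelof i) subset_union_left SpI.continuous_toL
      Function.surjective_id
  · exact lindelof_freeBooleanGroup_of_SpI (hM.lindelof j) subset_union_left SpI.continuous_toR
      Function.surjective_id
  · obtain ⟨F, hF, hFd, hFc⟩ := exists_discreteFamily cI₁ cI₂ a₁ b₁ (fun c => rfl) ha₁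
      (fun x y h => SpI.isOpen_singleton (h ▸ hRA _ y.2 : x.val ∉ M i))
      (fun x y h => SpI.isOpen_singleton (h ▸ hLB _ x.2 : y.val ∉ M j))
    exact discreteSuslinNumber_eq hG₁ hF hFd (hC.trans hFc.ge)
  -- Jones' lemma: a separable normal space has no closed discrete subset of size `𝔠`.
  · have := hD.2.to_subtype
    exact hD.1.not_normal_of_continuum_le_mk hDc
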